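/- Let $-\infty\le a<b\le\infty$ and let $\varrho$, $\varsigma$, $\chi$ be locally finite Borel measures on $(a,b)$ (i.e. finite on compact subsets of $(a,b)$) such that: $\varrho$ is real-valued (signed); $\varsigma$ is positive with $\operatorname{supp}\varsigma=(a,b)$; $\chi$ is positive and $\chi\neq0$; and $\varsigma(\{x\})\chi(\{x\})=\varsigma(\{x\})\varrho(\{x\})=0$ for all $x\in(a,b)$. For a locally finite measure $\mu$ on $(a,b)$ write $\int_c^x h\,d\mu=\int_{[c,x)}h\,d\mu$ if $c\le x$ and $\int_c^x h\,d\mu=-\int_{[x,c)}h\,d\mu$ if $x<c$, and let $AC_{\mathrm{loc}}((a,b);\mu)$ be the set of functions $f:(a,b)\to\mathbb C$ of the form $f(x)=f(c)+\int_c^x h\,d\mu$ with $h\in L^1_{\mathrm{loc}}((a,b);\mu)$; put $df/d\mu=h$. A function $f\in AC_{\mathrm{loc}}((a,b);\varsigma)$ lies in $\mathfrak D_\tau$ if $df/d\varsigma$ has a representative $f^{[1]}$ (it is then unique, and defined everywhere on $(a,b)$) such that $x\mapsto -f^{[1]}(x)+\int_c^x f\,d\chi$ lies in $AC_{\mathrm{loc}}((a,b);\varrho)$;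 the derivative of this function with respect to $\varrho$ is denoted $\tau f\in L^1_{\mathrm{loc}}((a,b);\varrho)$. Let $H^1(a,b)$ be the space of all $f\in AC_{\mathrm{loc}}((a,b);\varsigma)$ with $f\in L^2((a,b);\chi)$ and $df/d\varsigma\in L^2((a,b);\varsigma)$, with inner product $$\langle f,g\rangle=\int_{(a,b)} f\,g^\ast\,d\chi+\int_{(a,b)}\frac{df}{d\varsigma}\Big(\frac{dg}{d\varsigma}\Big)^{\!\ast}\,d\varsigma ,$$ and let $$T_{\max}=\{(f,f_\tau)\in H^1(a,b)\times H^1(a,b)\;:\; f\in\mathfrak D_\tau,\ \tau f=f_\tau \text{ in } L^1_{\mathrm{loc}}((a,b);\varrho)\}.$$ For $f=(f,f_\tau)$ and $g=(g,g_\tau)$ in $T_{\max}$ put $V(f,g)(x)=f_\tau(x)g^{[1]}(x)-f^{[1]}(x)g_\tau(x)$, $x\in(a,b)$. Then for all $f,g\in T_{\max}$ the limits $V(f,g)(a)=\lim_{x\to a}V(f,g)(x)$ and $V(f,g)(b)=\lim_{x\to b}V(f,g)(x)$ exist in $\mathbb C$; the relation $T_{\max}$ is closed in $H^1(a,b)\times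 H^1(a,b)$; and its adjoint $T_{\max}^\ast=\{(u,v)\in H^1(a,b)\times H^1(a,b): \langle f_\tau,u\rangle=\langle f,v\rangle\ \text{for all } (f,f_\tau)\in T_{\max}\}$ is given by $$T_{\max}^\ast=\{f\in T_{\max}\;:\; V(f,g)(a)=V(f,g)(b)=0\ \text{ for all } g\in T_{\max}\}.$$ -/

import Mathlib

open MeasureTheory Set Filter Topology
open scoped ENNReal ComplexConjugate

noncomputable section

namespace LeftDefinite

/-! ## The open interval `(a, b)` -/

/-- The open interval `(a, b)` with endpoints `a, b ∈ [-∞, ∞]`, as a set of real numbers. -/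
def ivlSet (a b : EReal) : Set ℝ := {x : ℝ | a < (x : EReal) ∧ (x : EReal) < b}

/-- The open interval `(a, b)` as a linearly ordered topological space with its Borel sets.  Inside
this space `x → a` is the filter `atBot` and `x → b` is the filter `atTop`. -/
abbrev Ivl (a b : EReal) : Type := ↥(ivlSet a b)

section Ivl

variable {a b : EReal}

instance : OrdConnected (ivlSet a b) :=
  ⟨fun _ hx _ hy _ hz =>
    ⟨hx.1.trans_le (EReal.coe_le_coe_iff.2 hz.1), (EReal.coe_le_coe_iff.2 hz.2).trans_lt hy.2⟩⟩

instance : OrderTopology (Ivl a b) :=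
  orderTopology_of_ordConnected (t := ivlSet a b)

instance : CompactIccSpace (Ivl a b) := by
  refine ⟨fun {c d} => ?_⟩
  rw [Subtype.isCompact_iff]
  have h : Subtype.val '' Icc c d = Icc (c : ℝ) (d : ℝ) := by
    ext x
    constructor
    · rintro ⟨y, hy, rfl⟩
      exact hy
    · intro hx
      exact ⟨⟨x, c.2.1.trans_le (EReal.coe_le_coe_iff.2 hx.1),
        (EReal.coe_le_coe_iff.2 hx.2).trans_lt d.2.2⟩, hx, rfl⟩
  rw [h]
  exact isCompact_Icc

instance : NoMinOrder (Ivl a b) := by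
  refine ⟨fun x => ?_⟩
  obtain ⟨y, hy1, hy2⟩ := EReal.lt_iff_exists_real_btwn.1 x.2.1
  exact ⟨⟨y, hy1, hy2.trans x.2.2⟩, EReal.coe_lt_coe_iff.1 hy2⟩

instance : NoMaxOrder (Ivl a b) := by
  refine ⟨fun x => ?_⟩
  obtain ⟨y, hy1, hy2⟩ := EReal.lt_iff_exists_real_btwn.1 x.2.2
  exact ⟨⟨y, x.2.1.trans hy1, hy2⟩, EReal.coe_lt_coe_iff.1 hy1⟩

instance : DenselyOrdered (Ivl a b) := by
  refine ⟨fun x y hxy => ?_⟩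
  obtain ⟨z, hz1, hz2⟩ := exists_between (show (x : ℝ) < y from hxy)
  exact ⟨⟨z, x.2.1.trans (EReal.coe_lt_coe_iff.2 hz1), (EReal.coe_lt_coe_iff.2 hz2).trans y.2.2⟩,
    hz1, hz2⟩

end Ivl

/-! ## Integrals and absolute continuity with respect to a measure -/

section AC

variable {a b : EReal}

/-- `∫_c^x h dμ`, that is `∫_{[c,x)} h dμ` for `c ≤ x` and `-∫_{[x,c)} h dμ` for `x < c`. -/
def oint (μ : Measure (Ivl a b)) (h : Ivl a b → ℂ) (c x : Ivl a b) : ℂ :=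
  if c ≤ x then ∫ t in Ico c x, h t ∂μ else -∫ t in Ico x c, h t ∂μ

/-- `f ∈ AC_loc((a,b); μ)` with `df/dμ = h`, for a positive measure `μ`. -/
def HasRN (μ : Measure (Ivl a b)) (f h : Ivl a b → ℂ) : Prop :=
  LocallyIntegrable h μ ∧ ∀ c x, f x = f c + oint μ h c x

/-- A real-valued (signed) Borel measure on `(a, b)` which is finite on compact subsets, given by
its Jordan decomposition. -/
structure RealMeasure (a b : EReal) where
  pos : Measure (Ivl a b)
  neg : Measure (Ivl a b)
  locallyFinite_pos : IsLocallyFiniteMeasure pos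
  locallyFinite_neg : IsLocallyFiniteMeasure neg
  mutuallySingular : pos ⟂ₘ neg

/-- The total variation `|ρ|`. -/
def RealMeasure.variation (ρ : RealMeasure a b) : Measure (Ivl a b) := ρ.pos + ρ.neg

/-- `∫_c^x h dρ` for a real-valued measure `ρ`. -/
def RealMeasure.oint (ρ : RealMeasure a b) (h : Ivl a b → ℂ) (c x : Ivl a b) : ℂ :=
  LeftDefinite.oint ρ.pos h c x - LeftDefinite.oint ρ.neg h c x

/-- `f ∈ AC_loc((a,b); ρ)` with `df/dρ = h`, for a real-valued measure `ρ`. -/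
def RealMeasure.HasRN (ρ : RealMeasure a b) (f h : Ivl a b → ℂ) : Prop :=
  LocallyIntegrable h ρ.variation ∧ ∀ c x, f x = f c + ρ.oint h c x

end AC

section Facts

variable {a b : EReal} {μ : Measure (Ivl a b)} {f g h k : Ivl a b → ℂ}

theorem integrableOn_Ico (hh : LocallyIntegrable h μ) (c d : Ivl a b) :
    IntegrableOn h (Ico c d) μ :=
  (hh.integrableOn_isCompact isCompact_Icc).mono_set Ico_subset_Icc_self

theorem oint_add (hh : LocallyIntegrable h μ) (hk : LocallyIntegrable k μ) (c x : Ivl a b) :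
    oint μ (h + k) c x = oint μ h c x + oint μ k c x := by
  unfold oint
  split_ifs
  · exact integral_add (integrableOn_Ico hh _ _) (integrableOn_Ico hk _ _)
  · rw [← neg_add]
    exact congrArg _ (integral_add (integrableOn_Ico hh _ _) (integrableOn_Ico hk _ _))

theorem oint_smul (z : ℂ) (c x : Ivl a b) : oint μ (z • h) c x = z * oint μ h c x := by
  unfold oint
  split_ifs
  · exact integral_const_mul z h
  · rw [mul_neg]
    exact congrArg _ (integral_const_mul z h)

theorem HasRN.zero : HasRN μ 0 0 := ⟨locallyIntegrable_zero, fun c x => by simp [oint]⟩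

theorem HasRN.add (hf : HasRN μ f h) (hg : HasRN μ g k) : HasRN μ (f + g) (h + k) :=
  ⟨hf.1.add hg.1, fun c x => by
    rw [oint_add hf.1 hg.1, Pi.add_apply, Pi.add_apply, hf.2 c x, hg.2 c x]; ring⟩

theorem HasRN.smul (z : ℂ) (hf : HasRN μ f h) : HasRN μ (z • f) (z • h) :=
  ⟨hf.1.smul z, fun c x => by
    rw [oint_smul, Pi.smul_apply, Pi.smul_apply, hf.2 c x, smul_eq_mul, smul_eq_mul]; ring⟩

theorem RealMeasure.HasRN.zero {ρ : RealMeasure a b} : ρ.HasRN 0 0 :=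
  ⟨locallyIntegrable_zero, fun c x => by simp [RealMeasure.oint, LeftDefinite.oint]⟩

theorem RealMeasure.HasRN.add {ρ : RealMeasure a b} (hf : ρ.HasRN f h) (hg : ρ.HasRN g k) :
    ρ.HasRN (f + g) (h + k) := by
  have hp : ∀ {u : Ivl a b → ℂ}, LocallyIntegrable u ρ.variation → LocallyIntegrable u ρ.pos :=
    fun hu => hu.mono_measure (Measure.le_add_right le_rfl)
  have hn : ∀ {u : Ivl a b → ℂ}, LocallyIntegrable u ρ.variation → LocallyIntegrable u ρ.neg :=
    fun hu => hu.mono_measure (Measure.le_add_left le_rfl)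
  refine ⟨hf.1.add hg.1, fun c x => ?_⟩
  rw [RealMeasure.oint, oint_add (hp hf.1) (hp hg.1), oint_add (hn hf.1) (hn hg.1),
    Pi.add_apply, Pi.add_apply, hf.2 c x, hg.2 c x, RealMeasure.oint, RealMeasure.oint]
  ring

theorem RealMeasure.HasRN.smul {ρ : RealMeasure a b} (z : ℂ) (hf : ρ.HasRN f h) :
    ρ.HasRN (z • f) (z • h) :=
  ⟨hf.1.smul z, fun c x => by
    rw [RealMeasure.oint, oint_smul, oint_smul, Pi.smul_apply, Pi.smul_apply, hf.2 c x,
      smul_eq_mul, smul_eq_mul, RealMeasure.oint]; ring⟩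

theorem ae_eq_zero_of_integral_Ico (hh : LocallyIntegrable h μ)
    (h0 : ∀ c d : Ivl a b, ∫ t in Ico c d, h t ∂μ = 0) : h =ᵐ[μ] 0 := by
  have key : ∀ c d : Ivl a b, h =ᵐ[μ.restrict (Ico c d)] 0 := by
    intro c d
    have hint : Integrable h (μ.restrict (Ico c d)) := integrableOn_Ico hh c d
    refine hint.ae_eq_zero_of_forall_setIntegral_eq_zero fun s hs hfin => ?_
    clear hfin
    induction s, hs using MeasurableSpace.induction_on_inter
      ((BorelSpace.measurable_eq (α := Ivl a b)).trans (borel_eq_generateFrom_Ico (Ivl a b)))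
      (isPiSystem_Ico (id : Ivl a b → Ivl a b) id) with
    | empty => simp
    | basic t ht =>
      obtain ⟨l, u, -, rfl⟩ := ht
      rw [Measure.restrict_restrict measurableSet_Ico]
      simp only [Ico_inter_Ico]
      exact h0 _ _
    | compl t ht ih =>
      have := integral_add_compl ht hint
      rw [ih, h0 c d, zero_add] at this
      exact this
    | iUnion t hd ht ih =>
      rw [integral_iUnion ht hd hint.integrableOn]
      simp [ih]
  refine measure_null_of_locally_null _ fun x _ => ?_
  obtain ⟨c, hc⟩ := exists_lt x
  obtain ⟨d, hd⟩ := exists_gt x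
  refine ⟨{t | h t ≠ 0} ∩ Ico c d,
    inter_mem_nhdsWithin _ (Ico_mem_nhds hc hd), ?_⟩
  have := key c d
  rw [Filter.EventuallyEq, ae_restrict_iff' measurableSet_Ico] at this
  refine measure_mono_null (fun t ht => ?_) this
  exact fun hcon => ht.1 (hcon ht.2)

/-- The Radon--Nikodym derivative is unique almost everywhere. -/
theorem HasRN.unique (h1 : HasRN μ f h) (h2 : HasRN μ f k) : h =ᵐ[μ] k := by
  have : h - k =ᵐ[μ] 0 := by
    refine ae_eq_zero_of_integral_Ico (h1.1.sub h2.1) fun c d => ?_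
    rcases le_or_gt c d with hcd | hcd
    · have e1 := h1.2 c d
      rw [h2.2 c d, oint, oint, if_pos hcd, if_pos hcd] at e1
      have := integral_sub (integrableOn_Ico h1.1 c d) (integrableOn_Ico h2.1 c d)
      simp only [Pi.sub_apply]
      rw [this, ← add_left_cancel e1, sub_self]
    · simp [Ico_eq_empty (not_lt.2 hcd.le)]
  filter_upwards [this] with t ht using sub_eq_zero.1 ht

theorem tendsto_oint_left (hh : LocallyIntegrable h μ) (c x : Ivl a b) (hcx : c < x) :
    Tendsto (oint μ h c) (𝓝[<] x) (𝓝 (oint μ h c x)) := by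
  have hI : IntegrableOn h (Ico c x) μ := integrableOn_Ico hh c x
  have e : ∀ y ∈ Ico c x, oint μ h c y = ∫ t in Ico c x, (Ico c y).indicator h t ∂μ := by
    intro y hy
    rw [oint, if_pos hy.1, setIntegral_indicator measurableSet_Ico,
      inter_eq_self_of_subset_right (Ico_subset_Ico_right hy.2.le)]
  have e' : oint μ h c x = ∫ t in Ico c x, h t ∂μ := by rw [oint, if_pos hcx.le]
  rw [e']
  refine Tendsto.congr' (f₁ := fun y => ∫ t in Ico c x, (Ico c y).indicator h t ∂μ) ?_ ?_
  · filter_upwards [Ico_mem_nhdsLT hcx] with y hy using (e y hy).symm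
  · refine tendsto_integral_filter_of_dominated_convergence (fun t => ‖h t‖) ?_ ?_ hI.norm ?_
    · exact Eventually.of_forall fun y => hI.aestronglyMeasurable.indicator measurableSet_Ico
    · exact Eventually.of_forall fun y => Eventually.of_forall fun t => norm_indicator_le_norm_self _ _
    · filter_upwards [ae_restrict_mem measurableSet_Ico] with t ht
      refine tendsto_const_nhds.congr' ?_
      filter_upwards [Ioo_mem_nhdsLT ht.2] with y hy
      rw [indicator_of_mem]
      exact ⟨ht.1, hy.1⟩

end Facts

/-! ## Left-definite coefficients -/

/-- The coefficients `ϱ`, `ς`, `χ` of a left-definite differential expression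
`τ f = d/dϱ (-df/dς + ∫ f dχ)` on `(a, b)`: locally finite Borel measures such that `ϱ` is
real-valued, `ς` is positive and supported on the whole interval, `χ` is positive and not zero, and
`ς` has no point masses in common with `χ` or `ϱ`.  (Since `χ ≠ 0`, this forces `a < b`.) -/
structure Coeff (a b : EReal) where
  rho : RealMeasure a b
  sigma : Measure (Ivl a b)
  chi : Measure (Ivl a b)
  locallyFinite_sigma : IsLocallyFiniteMeasure sigma
  locallyFinite_chi : IsLocallyFiniteMeasure chi
  support_sigma : ∀ U : Set (Ivl a b), IsOpen U → U.Nonempty → sigma U ≠ 0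
  chi_ne_zero : chi ≠ 0
  sep_chi : ∀ x, sigma {x} * chi {x} = 0
  sep_rho : ∀ x, sigma {x} * rho.variation {x} = 0

namespace Coeff

variable {a b : EReal} (C : Coeff a b)

/-! ## The differential expression and the relation `T_loc` -/

/-- `f` lies in the maximal domain `𝔇_τ`, the function `q` is its quasi-derivative `f^{[1]}`, and
`τ f = g`: the representative `q` of `df/dς` is such that `-q + ∫_c^x f dχ` lies in
`AC_loc((a,b); ϱ)` with Radon--Nikodym derivative `g`. -/
def IsTau (f q g : Ivl a b → ℂ) : Prop :=
  HasRN C.sigma f q ∧ ∀ c, C.rho.HasRN (fun x => -q x + oint C.chi f c x) g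

/-- The quasi-derivative `f^{[1]}` of a function `f ∈ 𝔇_τ`, as a function defined everywhere
(zero if `f ∉ 𝔇_τ`). -/
def quasiDeriv (f : Ivl a b → ℂ) : Ivl a b → ℂ :=
  open Classical in if hf : ∃ q g, C.IsTau f q g then hf.choose else 0

/-- The linear relation `T_loc` in `AC_loc((a,b); ς)`. -/
def Tloc : Set ((Ivl a b → ℂ) × (Ivl a b → ℂ)) :=
  {p | (∃ q, HasRN C.sigma p.1 q) ∧ (∃ q, HasRN C.sigma p.2 q) ∧ ∃ q, C.IsTau p.1 q p.2}

/-- The modified Wronskian `V(f, g)(x) = f_τ(x) g^{[1]}(x) - f^{[1]}(x) g_τ(x)` of two pairs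
`f = (f, f_τ)` and `g = (g, g_τ)`. -/
def V (f g : (Ivl a b → ℂ) × (Ivl a b → ℂ)) (x : Ivl a b) : ℂ :=
  f.2 x * C.quasiDeriv g.1 x - C.quasiDeriv f.1 x * g.2 x

variable {C} in
theorem IsTau.zero : C.IsTau 0 0 0 := by
  refine ⟨HasRN.zero, fun c => ?_⟩
  convert RealMeasure.HasRN.zero (ρ := C.rho) using 1
  funext x
  simp [oint]

variable {C} in
theorem IsTau.add {f₁ q₁ g₁ f₂ q₂ g₂ : Ivl a b → ℂ} (h₁ : C.IsTau f₁ q₁ g₁)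
    (h₂ : C.IsTau f₂ q₂ g₂) (hf₁ : LocallyIntegrable f₁ C.chi) (hf₂ : LocallyIntegrable f₂ C.chi) :
    C.IsTau (f₁ + f₂) (q₁ + q₂) (g₁ + g₂) := by
  refine ⟨h₁.1.add h₂.1, fun c => ?_⟩
  convert (h₁.2 c).add (h₂.2 c) using 1
  funext x
  rw [oint_add hf₁ hf₂]
  simp only [Pi.add_apply]
  ring

variable {C} in
theorem IsTau.smul {f q g : Ivl a b → ℂ} (z : ℂ) (h : C.IsTau f q g) :
    C.IsTau (z • f) (z • q) (z • g) := by
  refine ⟨h.1.smul z, fun c => ?_⟩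
  convert (h.2 c).smul z using 1
  funext x
  rw [oint_smul]
  simp only [Pi.smul_apply, smul_eq_mul]
  ring

variable {C} in
/-- The quasi-derivative is uniquely determined everywhere on `(a, b)`. -/
theorem IsTau.quasiDeriv_eq {f q g : Ivl a b → ℂ} (h : C.IsTau f q g) : C.quasiDeriv f = q := by
  have hex : ∃ q g, C.IsTau f q g := ⟨q, g, h⟩
  obtain ⟨g', h'⟩ := hex.choose_spec
  have hq : C.quasiDeriv f = hex.choose := dif_pos hex
  rw [← hq] at h'
  set p := C.quasiDeriv f
  have hae : p =ᵐ[C.sigma] q := h'.1.unique h.1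
  have hlc : ∀ {F u : Ivl a b → ℂ}, C.rho.HasRN F u → ∀ x, Tendsto F (𝓝[<] x) (𝓝 (F x)) := by
    intro F u hF x
    obtain ⟨y, hy⟩ := exists_lt x
    have h1 := tendsto_oint_left (hF.1.mono_measure (Measure.le_add_right le_rfl)) y x hy
    have h2 := tendsto_oint_left (hF.1.mono_measure (Measure.le_add_left le_rfl)) y x hy
    have h3 := (h1.sub h2).const_add (F y)
    rw [hF.2 y x]
    exact h3.congr fun z => (hF.2 y z).symm
  funext x
  by_contra hne
  have hd : Tendsto (fun y => p y - q y) (𝓝[<] x) (𝓝 (p x - q x)) := by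
    have := (hlc (h.2 x) x).sub (hlc (h'.2 x) x)
    simpa [add_comm, ← sub_eq_add_neg] using this
  have hev : ∀ᶠ y in 𝓝[<] x, p y - q y ≠ 0 := hd.eventually_ne (sub_ne_zero.2 hne)
  obtain ⟨l, hl, hsub⟩ := (mem_nhdsLT_iff_exists_Ioo_subset).1 hev
  refine C.support_sigma (Ioo l x) isOpen_Ioo (nonempty_Ioo.2 hl) ?_
  exact measure_mono_null (fun y hy => sub_ne_zero.1 (hsub hy)) hae

/-! ## The modified Sobolev space `H¹(a, b)` -/

/-- The functions that are locally absolutely continuous with respect to `ς`, square integrable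
with respect to `χ`, and whose Radon--Nikodym derivative is square integrable with respect to
`ς`. -/
def H1Submodule : Submodule ℂ (Ivl a b → ℂ) where
  carrier := {f | MemLp f 2 C.chi ∧ ∃ q, HasRN C.sigma f q ∧ MemLp q 2 C.sigma}
  zero_mem' := ⟨MemLp.zero, 0, HasRN.zero, MemLp.zero⟩
  add_mem' := fun ⟨hf, q, hq, hq2⟩ ⟨hg, r, hr, hr2⟩ => ⟨hf.add hg, q + r, hq.add hr, hq2.add hr2⟩
  smul_mem' := fun z _ ⟨hf, q, hq, hq2⟩ => ⟨hf.const_smul z, z • q, hq.smul z, hq2.const_smul z⟩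

/-- The modified Sobolev space `H¹(a, b)`; its norm and inner product are defined below. -/
def H1 : Type := C.H1Submodule

namespace H1

variable {C}

instance : AddCommGroup C.H1 := inferInstanceAs (AddCommGroup C.H1Submodule)

instance : Module ℂ C.H1 := inferInstanceAs (Module ℂ C.H1Submodule)

/-- An element of `H¹(a, b)` as a function on `(a, b)`. -/
def fn (f : C.H1) : Ivl a b → ℂ := f.1

theorem fn_add (f g : C.H1) : (f + g).fn = f.fn + g.fn := rfl

theorem fn_smul (z : ℂ) (f : C.H1) : (z • f).fn = z • f.fn := rfl

theorem fn_zero : (0 : C.H1).fn = 0 := rfl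

theorem fn_injective : Function.Injective (fn : C.H1 → Ivl a b → ℂ) := Subtype.val_injective

/-- The Radon--Nikodym derivative `df/dς` (a representative of it). -/
def deriv (f : C.H1) : Ivl a b → ℂ := f.2.2.choose

theorem memLp_fn (f : C.H1) : MemLp f.fn 2 C.chi := f.2.1

theorem hasRN (f : C.H1) : HasRN C.sigma f.fn f.deriv := f.2.2.choose_spec.1

theorem memLp_deriv (f : C.H1) : MemLp f.deriv 2 C.sigma := f.2.2.choose_spec.2

theorem deriv_add (f g : C.H1) : (f + g).deriv =ᵐ[C.sigma] f.deriv + g.deriv :=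
  (f + g).hasRN.unique (f.hasRN.add g.hasRN)

theorem deriv_smul (z : ℂ) (f : C.H1) : (z • f).deriv =ᵐ[C.sigma] z • f.deriv :=
  (z • f).hasRN.unique (f.hasRN.smul z)

theorem locallyIntegrable_fn (f : C.H1) : LocallyIntegrable f.fn C.chi :=
  have := C.locallyFinite_chi
  f.memLp_fn.locallyIntegrable (by norm_num)

/-- The inner product `∫ f^* g dχ + ∫ (df/dς)^* (dg/dς) dς`, conjugate linear in the first
argument. -/
def innerProd (f g : C.H1) : ℂ :=
  (∫ x, conj (f.fn x) * g.fn x ∂C.chi) + ∫ x, conj (f.deriv x) * g.deriv x ∂C.sigma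

theorem integrable_conj_mul {μ : Measure (Ivl a b)} {u v : Ivl a b → ℂ} (hu : MemLp u 2 μ)
    (hv : MemLp v 2 μ) : Integrable (fun x => conj (u x) * v x) μ :=
  MemLp.integrable_mul (p := 2) (q := 2) hu.star hv

theorem integral_conj_mul_self (μ : Measure (Ivl a b)) (u : Ivl a b → ℂ) :
    ∫ x, conj (u x) * u x ∂μ = ((∫ x, ‖u x‖ ^ 2 ∂μ : ℝ) : ℂ) := by
  rw [← integral_complex_ofReal]
  refine integral_congr_ae (Eventually.of_forall fun x => ?_)
  simp [Complex.conj_mul']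

theorem innerProd_self (f : C.H1) :
    innerProd f f = ((∫ x, ‖f.fn x‖ ^ 2 ∂C.chi) + ∫ x, ‖f.deriv x‖ ^ 2 ∂C.sigma : ℝ) := by
  rw [innerProd, integral_conj_mul_self, integral_conj_mul_self, Complex.ofReal_add]

theorem ae_zero_of_integral {μ : Measure (Ivl a b)} {u : Ivl a b → ℂ} (hu : MemLp u 2 μ)
    (h : ∫ x, ‖u x‖ ^ 2 ∂μ = 0) : u =ᵐ[μ] 0 := by
  rw [integral_eq_zero_iff_of_nonneg (fun x => sq_nonneg _)
    ((memLp_two_iff_integrable_sq_norm hu.1).1 hu)] at h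
  filter_upwards [h] with x hx
  simpa using hx

/-- `H¹(a, b)` carries a positive definite inner product. -/
@[reducible] def core : InnerProductSpace.Core ℂ C.H1 where
  inner := innerProd
  conj_inner_symm f g := by
    simp only [innerProd, map_add, ← integral_conj, map_mul, Complex.conj_conj]
    simp only [mul_comm]
  re_inner_nonneg f := by
    rw [innerProd_self]
    exact add_nonneg (integral_nonneg fun _ => sq_nonneg _) (integral_nonneg fun _ => sq_nonneg _)
  add_left f g h := by
    have e1 : ∫ x, conj ((f + g).fn x) * h.fn x ∂C.chi =
        (∫ x, conj (f.fn x) * h.fn x ∂C.chi) + ∫ x, conj (g.fn x) * h.fn x ∂C.chi := by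
      rw [← integral_add (integrable_conj_mul f.memLp_fn h.memLp_fn)
        (integrable_conj_mul g.memLp_fn h.memLp_fn)]
      simp [fn_add, add_mul]
    have e2 : ∫ x, conj ((f + g).deriv x) * h.deriv x ∂C.sigma =
        (∫ x, conj (f.deriv x) * h.deriv x ∂C.sigma) +
          ∫ x, conj (g.deriv x) * h.deriv x ∂C.sigma := by
      rw [← integral_add (integrable_conj_mul f.memLp_deriv h.memLp_deriv)
        (integrable_conj_mul g.memLp_deriv h.memLp_deriv)]
      refine integral_congr_ae ?_
      filter_upwards [deriv_add f g] with x hx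
      simp [hx, add_mul]
    simp only [innerProd, e1, e2]
    ring
  smul_left f g z := by
    have e1 : ∫ x, conj ((z • f).fn x) * g.fn x ∂C.chi =
        conj z * ∫ x, conj (f.fn x) * g.fn x ∂C.chi := by
      rw [← integral_const_mul]
      simp [fn_smul, mul_assoc]
    have e2 : ∫ x, conj ((z • f).deriv x) * g.deriv x ∂C.sigma =
        conj z * ∫ x, conj (f.deriv x) * g.deriv x ∂C.sigma := by
      rw [← integral_const_mul]
      refine integral_congr_ae ?_
      filter_upwards [deriv_smul z f] with x hx
      simp [hx, mul_assoc]
    simp only [innerProd, e1, e2]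
    ring
  definite f hf := by
    change innerProd f f = 0 at hf
    rw [innerProd_self, Complex.ofReal_eq_zero] at hf
    have n1 : 0 ≤ ∫ x, ‖f.fn x‖ ^ 2 ∂C.chi := integral_nonneg fun _ => sq_nonneg _
    have n2 : 0 ≤ ∫ x, ‖f.deriv x‖ ^ 2 ∂C.sigma := integral_nonneg fun _ => sq_nonneg _
    have z1 := ae_zero_of_integral f.memLp_fn (by linarith)
    have z2 := ae_zero_of_integral f.memLp_deriv (by linarith)
    have hint : ∀ s : Set (Ivl a b), ∫ t in s, f.deriv t ∂C.sigma = 0 := fun s => by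
      rw [integral_congr_ae (ae_restrict_of_ae z2)]
      simp
    have hconst : ∀ c x, f.fn x = f.fn c := fun c x => by
      have := f.hasRN.2 c x
      rw [this, oint]
      simp [hint]
    apply fn_injective
    funext x
    by_contra hx
    refine C.chi_ne_zero (Measure.measure_univ_eq_zero.1 ?_)
    refine measure_mono_null (fun y _ => ?_) z1
    change ¬ f.fn y = 0
    rw [hconst x y]
    exact hx

instance : NormedAddCommGroup C.H1 := core.toNormedAddCommGroup

instance : InnerProductSpace ℂ C.H1 := InnerProductSpace.ofCore core.toCore

theorem inner_eq (f g : C.H1) : inner ℂ f g = innerProd f g := rfl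

end H1

/-! ## The maximal relation -/

/-- The pair of functions underlying a pair of elements of `H¹(a, b)`. -/
def fnPair (p : C.H1 × C.H1) : (Ivl a b → ℂ) × (Ivl a b → ℂ) := (p.1.fn, p.2.fn)

/-- The maximal relation `T_max` in `H¹(a, b)`: all `(f, f_τ) ∈ H¹(a, b) × H¹(a, b)` that lie in
`T_loc`. -/
def Tmax : Submodule ℂ (C.H1 × C.H1) where
  carrier := {p | C.fnPair p ∈ C.Tloc}
  zero_mem' := ⟨⟨0, HasRN.zero⟩, ⟨0, HasRN.zero⟩, 0, IsTau.zero⟩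
  add_mem' := fun {p r} ⟨⟨q₁, h₁⟩, ⟨q₂, h₂⟩, q₃, h₃⟩ ⟨⟨s₁, k₁⟩, ⟨s₂, k₂⟩, s₃, k₃⟩ =>
    ⟨⟨q₁ + s₁, h₁.add k₁⟩, ⟨q₂ + s₂, h₂.add k₂⟩, q₃ + s₃,
      h₃.add k₃ p.1.locallyIntegrable_fn r.1.locallyIntegrable_fn⟩
  smul_mem' := fun z _ ⟨⟨q₁, h₁⟩, ⟨q₂, h₂⟩, q₃, h₃⟩ =>
    ⟨⟨z • q₁, h₁.smul z⟩, ⟨z • q₂, h₂.smul z⟩, z • q₃, h₃.smul z⟩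

end Coeff

end LeftDefinite

end

/-! Everything rests on integrating a product `φ * f^{[1]}` by parts (`ibp`, `green`). Since `ς`
shares no atoms with `χ` or `ϱ`, no jump terms appear, and the increment of the product over `[x,
y)` is the bilinear form `bil` of `φ` and `f` on `[x, y)` minus `∫ φ f_τ dϱ`. Taking `φ = g_τ`,
exchanging the roles of the two pairs and subtracting cancels the `ϱ`-integrals: this is the
Lagrange identity `V_sub_V`. Its right side is made of integrable products, so both limits of `V`
exist and differ by the global form `bil(f_τ, g) - bil(f, g_τ)`. As `T_max` is invariant under
conjugation, vanishing boundary values give membership in the adjoint.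

For closedness, `T_max` is characterised weakly (`mem_Tmax_iff_weak`): `⟨φ, u⟩ = ∫ φ^* v dϱ` for
every `φ` in `H¹` vanishing outside a compact interval. The nontrivial direction is a du
Bois-Reymond argument (`exists_ae_eq_const_of_weak`). Point evaluations are bounded locally
uniformly (`exists_norm_fn_le`), so each of these conditions is closed.

For the adjoint, pairs in `T_max` are produced by the Riesz theorem, for which `H¹` has to be
complete. If `φ` has compact support, the representer `h` of `ψ ↦ ∫ φ ψ dϱ` satisfies `(h, φ) ∈
T_max`; testing an element of the adjoint against `(h, φ)` returns its weak equation
(`mem_Tmax_of_mem_adjoint`). To isolate the endpoint `a`, a cut-off `K` keeps functions near `a` and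
kills them near `b`. A suitable pair `(h, K g_τ) ∈ T_max` (`exists_cut_mem_Tmax`), tested against an
adjoint element `f`, forces `V(f, g)` to vanish at `a`. The global identity then gives vanishing at
`b`. -/

namespace LeftDefinite

variable {a b : EReal}

/-! ### Locally absolutely continuous functions -/

section AC

variable {μ ν : Measure (Ivl a b)} {f g h k : Ivl a b → ℂ}

theorem oint_of_le {c x : Ivl a b} (hcx : c ≤ x) : oint μ h c x = ∫ t in Ico c x, h t ∂μ :=
  if_pos hcx

theorem oint_symm (c x : Ivl a b) : oint μ h x c = -oint μ h c x := by
  rcases lt_trichotomy c x with hlt | rfl | hlt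
  · simp [oint, hlt.le, hlt.not_ge]
  · simp [oint]
  · simp [oint, hlt.le, hlt.not_ge]

theorem oint_self (c : Ivl a b) : oint μ h c c = 0 := by simp [oint]

theorem setIntegral_Ico_add (hh : LocallyIntegrable h μ) {x y z : Ivl a b} (hxy : x ≤ y)
    (hyz : y ≤ z) :
    (∫ t in Ico x y, h t ∂μ) + ∫ t in Ico y z, h t ∂μ = ∫ t in Ico x z, h t ∂μ := by
  rw [← Ico_union_Ico_eq_Ico hxy hyz, setIntegral_union Ico_disjoint_Ico_same measurableSet_Ico
    (integrableOn_Ico hh _ _) (integrableOn_Ico hh _ _)]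

theorem oint_add_adjacent (hh : LocallyIntegrable h μ) (x y z : Ivl a b) :
    oint μ h x y + oint μ h y z = oint μ h x z := by
  have key : ∀ {x y z : Ivl a b}, x ≤ y → y ≤ z → oint μ h x y + oint μ h y z = oint μ h x z := by
    intro x y z hxy hyz
    rw [oint_of_le hxy, oint_of_le hyz, oint_of_le (hxy.trans hyz), setIntegral_Ico_add hh hxy hyz]
  have s := fun c x : Ivl a b => oint_symm (μ := μ) (h := h) c x
  rcases le_total x y with hxy | hxy <;> rcases le_total y z with hyz | hyz <;>
    rcases le_total x z with hxz | hxz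
  · exact key hxy hyz
  · exact key hxy hyz
  · linear_combination s z y - key hxz hyz
  · linear_combination key hxz hxy + s z y - s z x
  · linear_combination s y x - key hxy hxz
  · linear_combination key hyz hxz + s y x - s z x
  · linear_combination s y x + s z y - s z x - key hyz hxy
  · linear_combination s y x + s z y - s z x - key hyz hxy

theorem HasRN.oint (hh : LocallyIntegrable h μ) (z : ℂ) (c : Ivl a b) :
    HasRN μ (fun x => z + LeftDefinite.oint μ h c x) h :=
  ⟨hh, fun d x => by rw [add_assoc, oint_add_adjacent hh]⟩

theorem HasRN.sub_eq (hf : HasRN μ f h) {x y : Ivl a b} (hxy : x ≤ y) :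
    f y - f x = ∫ t in Ico x y, h t ∂μ := by
  rw [hf.2 x y, oint_of_le hxy, add_sub_cancel_left]

theorem HasRN.norm_le (hf : HasRN μ f h) {c d x y : Ivl a b} (hx : x ∈ Icc c d)
    (hy : y ∈ Icc c d) : ‖f x‖ ≤ ‖f y‖ + ∫ t in Ico c d, ‖h t‖ ∂μ := by
  have key : ∀ {u v : Ivl a b}, c ≤ u → u ≤ v → v ≤ d →
      ‖f v - f u‖ ≤ ∫ t in Ico c d, ‖h t‖ ∂μ := by
    intro u v hu huv hv
    rw [hf.sub_eq huv]
    refine (norm_integral_le_integral_norm _).trans ?_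
    exact setIntegral_mono_set (integrableOn_Ico hf.1 c d).norm
      (Eventually.of_forall fun _ => norm_nonneg _) (Ico_subset_Ico hu hv).eventuallyLE
  have : ‖f x - f y‖ ≤ ∫ t in Ico c d, ‖h t‖ ∂μ := by
    rcases le_total x y with hxy | hxy
    · rw [norm_sub_rev]
      exact key hx.1 hxy hy.2
    · exact key hy.1 hxy hx.2
  calc ‖f x‖ = ‖f y + (f x - f y)‖ := by rw [add_sub_cancel]
    _ ≤ ‖f y‖ + ‖f x - f y‖ := norm_add_le _ _
    _ ≤ _ := by gcongr

theorem HasRN.exists_bound (hf : HasRN μ f h) (c d : Ivl a b) :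
    ∃ K, ∀ x ∈ Icc c d, ‖f x‖ ≤ K := by
  refine ⟨‖f c‖ + ∫ t in Ico c d, ‖h t‖ ∂μ, fun x hx => ?_⟩
  exact hf.norm_le hx (left_mem_Icc.2 (hx.1.trans hx.2))

theorem HasRN.congr (hf : HasRN μ f h) (hk : h =ᵐ[μ] k) : HasRN μ f k := by
  refine ⟨hf.1.congr hk, fun c x => ?_⟩
  rw [hf.2 c x, LeftDefinite.oint, LeftDefinite.oint, integral_congr_ae (ae_restrict_of_ae hk),
    integral_congr_ae (ae_restrict_of_ae hk)]

theorem HasRN.conj (hf : HasRN μ f h) :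
    HasRN μ (fun x => conj (f x)) (fun x => conj (h x)) := by
  refine ⟨?_, fun c x => ?_⟩
  · intro x
    obtain ⟨s, hs, hi⟩ := hf.1 x
    exact ⟨s, hs, (Complex.conjCLE.toContinuousLinearMap.integrable_comp hi)⟩
  · change conj (f x) = conj (f c) + _
    rw [hf.2 c x, map_add]
    congr 1
    unfold LeftDefinite.oint
    split_ifs
    · exact integral_conj.symm
    · rw [map_neg]
      exact congrArg _ integral_conj.symm

/-- After replacing `h` by a strongly measurable version, `f` is a parameter integral of a jointly
measurable function of `(x, t)`. -/
theorem HasRN.stronglyMeasurable [IsLocallyFiniteMeasure μ] (hf : HasRN μ f h) :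
    StronglyMeasurable f := by
  rcases isEmpty_or_nonempty (Ivl a b) with he | ⟨⟨c⟩⟩
  · exact (measurable_of_empty f).stronglyMeasurable
  have hm := hf.1.aestronglyMeasurable
  have hf' := hf.congr hm.ae_eq_mk
  have hk := hm.stronglyMeasurable_mk
  set k := hm.mk h
  have e : f = fun x => f c + ((∫ t, {t | c ≤ t ∧ t < x}.indicator k t ∂μ) -
      ∫ t, {t | x ≤ t ∧ t < c}.indicator k t ∂μ) := by
    funext x
    have e1 : {t | c ≤ t ∧ t < x} = Ico c x := rfl
    have e2 : {t | x ≤ t ∧ t < c} = Ico x c := rfl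
    rw [e1, e2, integral_indicator measurableSet_Ico, integral_indicator measurableSet_Ico, hf'.2 c x,
      LeftDefinite.oint]
    split_ifs with hcx
    · simp [Ico_eq_empty hcx.not_gt]
    · simp [Ico_eq_empty (not_le.1 hcx).not_gt]
  rw [e]
  refine stronglyMeasurable_const.add (StronglyMeasurable.sub ?_ ?_)
  · refine StronglyMeasurable.integral_prod_right
      (f := fun x t : Ivl a b => {t | c ≤ t ∧ t < x}.indicator k t) ?_
    have : (Function.uncurry fun x t : Ivl a b => {t | c ≤ t ∧ t < x}.indicator k t) =
        {p : Ivl a b × Ivl a b | c ≤ p.2 ∧ p.2 < p.1}.indicator (fun p => k p.2) := rfl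
    have hlt : MeasurableSet {p : Ivl a b × Ivl a b | p.2 < p.1} :=
      measurableSet_lt measurable_snd measurable_fst
    rw [this]
    exact (hk.comp_measurable measurable_snd).indicator
      ((measurableSet_le measurable_const measurable_snd).inter
        hlt)
  · refine StronglyMeasurable.integral_prod_right
      (f := fun x t : Ivl a b => {t | x ≤ t ∧ t < c}.indicator k t) ?_
    have : (Function.uncurry fun x t : Ivl a b => {t | x ≤ t ∧ t < c}.indicator k t) =
        {p : Ivl a b × Ivl a b | p.1 ≤ p.2 ∧ p.2 < c}.indicator (fun p => k p.2) := rfl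
    have hlt : MeasurableSet {p : Ivl a b × Ivl a b | p.2 < c} :=
      measurableSet_lt measurable_snd measurable_const
    rw [this]
    exact (hk.comp_measurable measurable_snd).indicator
      ((measurableSet_le measurable_fst measurable_snd).inter
        hlt)

theorem HasRN.locallyIntegrable_mul [IsLocallyFiniteMeasure μ] (hf : HasRN μ f h)
    (hk : LocallyIntegrable k ν) : LocallyIntegrable (fun x => f x * k x) ν := by
  intro x
  obtain ⟨c, hc⟩ := exists_lt x
  obtain ⟨d, hd⟩ := exists_gt x
  refine ⟨Icc c d, Icc_mem_nhds hc hd, ?_⟩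
  obtain ⟨K, hK⟩ := hf.exists_bound c d
  refine Integrable.bdd_mul (c := K) (hk.integrableOn_isCompact isCompact_Icc)
    hf.stronglyMeasurable.aestronglyMeasurable ?_
  filter_upwards [ae_restrict_mem measurableSet_Icc] with t ht using hK t ht

theorem HasRN.locallyIntegrable [IsLocallyFiniteMeasure μ] [IsLocallyFiniteMeasure ν]
    (hf : HasRN μ f h) : LocallyIntegrable f ν := by
  simpa using hf.locallyIntegrable_mul (locallyIntegrable_const (1 : ℂ) (μ := ν))

/-- The atoms of `μ` form a countable set, each point of which is `ν`-null. -/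
theorem ae_measure_singleton_eq_zero [SFinite μ] (hat : ∀ x, μ {x} * ν {x} = 0) :
    ∀ᵐ t ∂ν, μ {t} = 0 := by
  have hc : {t | 0 < μ {t}}.Countable := by
    simpa using Measure.countable_meas_level_set_pos (μ := μ) (g := (id : Ivl a b → Ivl a b))
      measurable_id
  have : ν {t | 0 < μ {t}} = 0 := by
    refine (measure_null_iff_singleton hc).2 fun t ht => ?_
    exact (mul_eq_zero.1 (hat t)).resolve_left ht.ne'
  filter_upwards [measure_eq_zero_iff_ae_notMem.1 this] with t ht
  simpa using ht

/-- Integration by parts for measures without common atoms. -/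
theorem HasRN.mul_sub_mul [IsLocallyFiniteMeasure μ] [IsLocallyFiniteMeasure ν]
    (hat : ∀ x, μ {x} * ν {x} = 0) (hf : HasRN μ f h) (hg : HasRN ν g k) {x y : Ivl a b}
    (hxy : x ≤ y) :
    f y * g y - f x * g x =
      (∫ t in Ico x y, h t * g t ∂μ) + ∫ t in Ico x y, f t * k t ∂ν := by
  have ih : IntegrableOn h (Ico x y) μ := integrableOn_Ico hf.1 x y
  have ik : IntegrableOn k (Ico x y) ν := integrableOn_Ico hg.1 x y
  have ihg : IntegrableOn (fun t => h t * g t) (Ico x y) μ := by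
    simpa only [mul_comm] using integrableOn_Ico (hg.locallyIntegrable_mul hf.1) x y
  have ifk : IntegrableOn (fun t => f t * k t) (Ico x y) ν :=
    integrableOn_Ico (hf.locallyIntegrable_mul hg.1) x y
  have iprod : Integrable (fun p : Ivl a b × Ivl a b => h p.1 * k p.2)
      ((μ.restrict (Ico x y)).prod (ν.restrict (Ico x y))) := Integrable.mul_prod ih ik
  -- Fubini for `h(s) k(t)` on the triangle `s ≤ t` in `[x, y)²`; the two iterated integrals produce
  -- the two terms of the formula.
  have swap := integral_integral_swap
    (f := fun s t => {p : Ivl a b × Ivl a b | p.1 ≤ p.2}.indicator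
      (fun p => h p.1 * k p.2) (s, t))
    (iprod.indicator (measurableSet_le measurable_fst measurable_snd))
  have hl : ∀ s ∈ Ico x y, ∫ t in Ico x y, {p : Ivl a b × Ivl a b | p.1 ≤ p.2}.indicator
      (fun p => h p.1 * k p.2) (s, t) ∂ν = h s * g y - h s * g s := by
    intro s hs
    have e : ∀ t, {p : Ivl a b × Ivl a b | p.1 ≤ p.2}.indicator (fun p => h p.1 * k p.2) (s, t) =
        (Ici s).indicator (fun t => h s * k t) t := fun t => rfl
    simp_rw [e]
    rw [setIntegral_indicator measurableSet_Ici]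
    have : Ico x y ∩ Ici s = Ico s y := by
      ext t; exact ⟨fun ht => ⟨ht.2, ht.1.2⟩, fun ht => ⟨⟨hs.1.trans ht.1, ht.2⟩, ht.1⟩⟩
    rw [this, integral_const_mul, ← hg.sub_eq hs.2.le]
    ring
  -- The inner integral runs over the closed interval `[x, t]`, whereas `f t - f x` is an integral
  -- over `[x, t)`. The discrepancy is the atom of `μ` at `t`, absent for `ν`-almost every `t`.
  have hr : ∀ᵐ t ∂ν.restrict (Ico x y),
      ∫ s in Ico x y, {p : Ivl a b × Ivl a b | p.1 ≤ p.2}.indicator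
      (fun p => h p.1 * k p.2) (s, t) ∂μ = f t * k t - f x * k t := by
    filter_upwards [ae_restrict_mem measurableSet_Ico,
      ae_restrict_of_ae (ae_measure_singleton_eq_zero hat)] with t ht h0
    have e : ∀ s, {p : Ivl a b × Ivl a b | p.1 ≤ p.2}.indicator (fun p => h p.1 * k p.2) (s, t) =
        (Iic t).indicator (fun s => h s * k t) s := fun s => rfl
    simp_rw [e]
    rw [setIntegral_indicator measurableSet_Iic]
    have : (Ico x y ∩ Iic t : Set (Ivl a b)) =ᵐ[μ] Ico x t := by
      have e2 : Ico x y ∩ Iic t = insert t (Ico x t) := by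
        rw [Ico_insert_right ht.1]
        ext s; exact ⟨fun hs => ⟨hs.1.1, hs.2⟩, fun hs => ⟨⟨hs.1, hs.2.trans_lt ht.2⟩, hs.2⟩⟩
      rw [e2, insert_eq]
      exact union_ae_eq_right_of_ae_eq_empty (ae_eq_empty.2 h0)
    rw [setIntegral_congr_set this, integral_mul_const, ← hf.sub_eq ht.1]
    ring
  rw [setIntegral_congr_fun measurableSet_Ico hl, integral_congr_ae hr,
    integral_sub (ih.mul_const _) ihg, integral_sub ifk (ik.const_mul _), integral_mul_const,
    integral_const_mul, ← hf.sub_eq hxy, ← hg.sub_eq hxy] at swap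
  linear_combination swap

end AC

/-! ### Real-valued measures -/

namespace RealMeasure

variable (ρ : RealMeasure a b) {h k : Ivl a b → ℂ}

instance : IsLocallyFiniteMeasure ρ.pos := ρ.locallyFinite_pos

instance : IsLocallyFiniteMeasure ρ.neg := ρ.locallyFinite_neg

instance : IsLocallyFiniteMeasure ρ.variation := by
  refine ⟨fun x => ?_⟩
  obtain ⟨s, hs, hs'⟩ := ρ.locallyFinite_pos.1 x
  obtain ⟨t, ht, ht'⟩ := ρ.locallyFinite_neg.1 x
  refine ⟨s ∩ t, inter_mem hs ht, ?_⟩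
  rw [variation, Measure.add_apply]
  exact ENNReal.add_lt_top.2 ⟨(measure_mono inter_subset_left).trans_lt hs',
    (measure_mono inter_subset_right).trans_lt ht'⟩

variable {ρ}

theorem locallyIntegrable_pos (hh : LocallyIntegrable h ρ.variation) :
    LocallyIntegrable h ρ.pos :=
  hh.mono_measure (Measure.le_add_right le_rfl)

theorem locallyIntegrable_neg (hh : LocallyIntegrable h ρ.variation) :
    LocallyIntegrable h ρ.neg :=
  hh.mono_measure (Measure.le_add_left le_rfl)

theorem oint_add (hh : LocallyIntegrable h ρ.variation) (hk : LocallyIntegrable k ρ.variation)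
    (c x : Ivl a b) : ρ.oint (h + k) c x = ρ.oint h c x + ρ.oint k c x := by
  rw [oint, LeftDefinite.oint_add (locallyIntegrable_pos hh) (locallyIntegrable_pos hk),
    LeftDefinite.oint_add (locallyIntegrable_neg hh) (locallyIntegrable_neg hk), oint, oint]
  ring

theorem oint_smul (z : ℂ) (c x : Ivl a b) : ρ.oint (z • h) c x = z * ρ.oint h c x := by
  rw [oint, LeftDefinite.oint_smul, LeftDefinite.oint_smul, oint]
  ring

theorem oint_add_adjacent (hh : LocallyIntegrable h ρ.variation) (x y z : Ivl a b) :
    ρ.oint h x y + ρ.oint h y z = ρ.oint h x z := by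
  rw [oint, oint, oint, ← LeftDefinite.oint_add_adjacent (locallyIntegrable_pos hh) x y z,
    ← LeftDefinite.oint_add_adjacent (locallyIntegrable_neg hh) x y z]
  ring

theorem oint_conj (c x : Ivl a b) : ρ.oint (fun t => conj (h t)) c x = conj (ρ.oint h c x) := by
  simp only [oint, LeftDefinite.oint]
  split_ifs <;> simp only [integral_conj, map_sub, map_neg]

theorem oint_congr {c d : Ivl a b} (hcd : c ≤ d) (hhk : ∀ t ∈ Ico c d, h t = k t) :
    ρ.oint h c d = ρ.oint k c d := by
  rw [oint, oint, oint_of_le hcd, oint_of_le hcd, oint_of_le hcd, oint_of_le hcd,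
    setIntegral_congr_fun measurableSet_Ico hhk, setIntegral_congr_fun measurableSet_Ico hhk]

theorem oint_eq_zero {c d : Ivl a b} (hcd : c ≤ d) (hh : ∀ t ∈ Ico c d, h t = 0) :
    ρ.oint h c d = 0 := by
  rw [oint_congr hcd (k := 0) hh]
  simp [oint, LeftDefinite.oint]

theorem norm_oint_le (hh : LocallyIntegrable h ρ.variation) {c d : Ivl a b} (hcd : c ≤ d) :
    ‖ρ.oint h c d‖ ≤ ∫ t in Ico c d, ‖h t‖ ∂ρ.variation := by
  rw [oint, oint_of_le hcd, oint_of_le hcd, variation, Measure.restrict_add,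
    integral_add_measure (integrableOn_Ico (locallyIntegrable_pos hh) c d).norm
      (integrableOn_Ico (locallyIntegrable_neg hh) c d).norm]
  exact (norm_sub_le _ _).trans
    (add_le_add (norm_integral_le_integral_norm _) (norm_integral_le_integral_norm _))

end RealMeasure

/-! ### Integration by parts with the quasi-derivative. -/

namespace Coeff

variable (C : Coeff a b)

instance : IsLocallyFiniteMeasure C.sigma := C.locallyFinite_sigma

instance : IsLocallyFiniteMeasure C.chi := C.locallyFinite_chi

theorem sep_pos (x : Ivl a b) : C.sigma {x} * C.rho.pos {x} = 0 := by
  have := C.sep_rho x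
  rw [RealMeasure.variation, Measure.add_apply, mul_add, add_eq_zero] at this
  exact this.1

theorem sep_neg (x : Ivl a b) : C.sigma {x} * C.rho.neg {x} = 0 := by
  have := C.sep_rho x
  rw [RealMeasure.variation, Measure.add_apply, mul_add, add_eq_zero] at this
  exact this.2

theorem exists_chi_Ico_ne_zero : ∃ c d, C.chi (Ico c d) ≠ 0 := by
  by_contra! hcon
  refine C.chi_ne_zero (Measure.measure_univ_eq_zero.1 ?_)
  refine measure_null_of_locally_null _ fun x _ => ?_
  obtain ⟨c, hc⟩ := exists_lt x
  obtain ⟨d, hd⟩ := exists_gt x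
  exact ⟨Ico c d, mem_nhdsWithin_of_mem_nhds (Ico_mem_nhds hc hd), hcon c d⟩

theorem nonempty_ivl (C : Coeff a b) : Nonempty (Ivl a b) := by
  obtain ⟨c, -⟩ := C.exists_chi_Ico_ne_zero
  exact ⟨c⟩

theorem sigma_Ico_ne_zero {c d : Ivl a b} (hcd : c < d) : C.sigma (Ico c d) ≠ 0 := fun h0 =>
  C.support_sigma (Ioo c d) isOpen_Ioo (nonempty_Ioo.2 hcd)
    (measure_mono_null Ioo_subset_Ico_self h0)

variable {C}
variable {f g q w p φ Q : Ivl a b → ℂ}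

/-- Up to a constant, `Q` is a combination of primitives with respect to `χ`, `ϱ⁺` and `ϱ⁻`. None of
these measures shares an atom with `ς`, so `HasRN.mul_sub_mul` applies to each primitive separately.
-/
theorem ibp (hφ : HasRN C.sigma φ p) (hg : LocallyIntegrable g C.chi)
    (hw : LocallyIntegrable w C.rho.variation)
    (hQ : ∀ c x, Q x = Q c + (oint C.chi g c x - C.rho.oint w c x)) {x y : Ivl a b} (hxy : x ≤ y) :
    φ y * Q y - φ x * Q x = (∫ t in Ico x y, φ t * g t ∂C.chi) +
      (∫ t in Ico x y, p t * Q t ∂C.sigma) - C.rho.oint (fun t => φ t * w t) x y := by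
  have hA := HasRN.oint hg (Q x) x
  have hP := HasRN.oint (RealMeasure.locallyIntegrable_pos hw) 0 x
  have hN := HasRN.oint (RealMeasure.locallyIntegrable_neg hw) 0 x
  have eA := hφ.mul_sub_mul C.sep_chi hA hxy
  have eP := hφ.mul_sub_mul C.sep_pos hP hxy
  have eN := hφ.mul_sub_mul C.sep_neg hN hxy
  have iA := integrableOn_Ico (hA.locallyIntegrable_mul hφ.1) x y
  have iP := integrableOn_Ico (hP.locallyIntegrable_mul hφ.1) x y
  have iN := integrableOn_Ico (hN.locallyIntegrable_mul hφ.1) x y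
  have hQ' : ∀ t, Q t = Q x + oint C.chi g x t - (0 + oint C.rho.pos w x t) +
      (0 + oint C.rho.neg w x t) := fun t => by
    rw [hQ x t, RealMeasure.oint]; ring
  have e : ∫ t in Ico x y, p t * Q t ∂C.sigma =
      (∫ t in Ico x y, p t * (Q x + oint C.chi g x t) ∂C.sigma) -
      (∫ t in Ico x y, p t * (0 + oint C.rho.pos w x t) ∂C.sigma) +
      ∫ t in Ico x y, p t * (0 + oint C.rho.neg w x t) ∂C.sigma := by
    simp only [mul_comm (p _)]
    refine (integral_congr_ae (Eventually.of_forall fun t => ?_)).trans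
      ((integral_add (iA.sub iP) iN).trans (congrArg (· + _) (integral_sub iA iP)))
    change Q t * p t = (Q x + oint C.chi g x t) * p t - (0 + oint C.rho.pos w x t) * p t +
      (0 + oint C.rho.neg w x t) * p t
    rw [hQ' t]
    ring
  rw [e, RealMeasure.oint, oint_of_le hxy, oint_of_le hxy, hQ' y]
  simp only [oint_self, add_zero] at eA eP eN
  linear_combination eA - eP + eN

theorem IsTau.quasi_eq (h : C.IsTau f q g) (c x : Ivl a b) :
    q x = q c + (oint C.chi f c x - C.rho.oint g c x) := by
  have := (h.2 c).2 c x
  simp only [oint_self, add_zero] at this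
  linear_combination -this

theorem isTau_of_quasi_eq (hf : HasRN C.sigma f q) (hg : LocallyIntegrable g C.rho.variation)
    (hq : ∀ c x, q x = q c + (oint C.chi f c x - C.rho.oint g c x)) : C.IsTau f q g := by
  refine ⟨hf, fun c => ⟨hg, fun d x => ?_⟩⟩
  change -q x + oint C.chi f c x = -q d + oint C.chi f c d + C.rho.oint g d x
  rw [hq d x, ← oint_add_adjacent (hf.locallyIntegrable) c d x]
  ring

theorem IsTau.conj (h : C.IsTau f q g) :
    C.IsTau (fun x => conj (f x)) (fun x => conj (q x)) (fun x => conj (g x)) := by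
  refine isTau_of_quasi_eq h.1.conj ?_ fun c x => ?_
  · intro x
    obtain ⟨s, hs, hi⟩ := (h.2 x).1 x
    exact ⟨s, hs, Complex.conjCLE.toContinuousLinearMap.integrable_comp hi⟩
  · have e := (HasRN.oint (h.1.locallyIntegrable (ν := C.chi)) 0 c).conj.2 c x
    simp only [oint_self, add_zero, map_zero, zero_add] at e
    rw [h.quasi_eq c x, RealMeasure.oint_conj, ← e, map_add, map_sub]

end Coeff

/-! ### Square integrable functions on compact intervals. -/

theorem measure_Ico_ne_top {μ : Measure (Ivl a b)} [IsLocallyFiniteMeasure μ] (c d : Ivl a b) : μ (Ico c d) ≠ ∞ :=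
  ((measure_mono Ico_subset_Icc_self).trans_lt isCompact_Icc.measure_lt_top).ne

theorem norm_toLp_sq_eq_integral {μ : Measure (Ivl a b)} {u : Ivl a b → ℂ} (hu : MemLp u 2 μ) :
    ‖hu.toLp u‖ ^ 2 = ∫ x, ‖u x‖ ^ 2 ∂μ := by
  rw [@norm_sq_eq_re_inner ℂ, L2.inner_def, ← integral_re (L2.integrable_inner _ _)]
  refine integral_congr_ae ?_
  filter_upwards [hu.coeFn_toLp] with x hx
  rw [hx, ← @norm_sq_eq_re_inner ℂ]

theorem setIntegral_norm_le {μ : Measure (Ivl a b)} [IsLocallyFiniteMeasure μ] {u : Ivl a b → ℂ}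
    (hu : MemLp u 2 μ) (c d : Ivl a b) :
    ∫ x in Ico c d, ‖u x‖ ∂μ ≤ μ.real (Ico c d) + ∫ x, ‖u x‖ ^ 2 ∂μ := by
  have hsq : Integrable (fun x => ‖u x‖ ^ 2) μ := (memLp_two_iff_integrable_sq_norm hu.1).1 hu
  have hfin : μ (Ico c d) ≠ ∞ := measure_Ico_ne_top _ _
  have hc : IntegrableOn (fun _ => (1 : ℝ)) (Ico c d) μ := integrableOn_const hfin
  calc ∫ x in Ico c d, ‖u x‖ ∂μ ≤ ∫ x in Ico c d, (1 + ‖u x‖ ^ 2) ∂μ := by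
        refine integral_mono
          (integrableOn_Ico (hu.locallyIntegrable (by norm_num)) c d).norm
          (hc.add hsq.integrableOn) fun x => ?_
        change ‖u x‖ ≤ 1 + ‖u x‖ ^ 2
        nlinarith [sq_nonneg (‖u x‖ - 1)]
    _ = μ.real (Ico c d) + ∫ x in Ico c d, ‖u x‖ ^ 2 ∂μ := by
        rw [integral_add hc hsq.integrableOn]
        simp
    _ ≤ _ := by
        gcongr
        · exact Eventually.of_forall fun x => sq_nonneg _
        · exact Measure.restrict_le_self

namespace Coeff

variable {C : Coeff a b}

namespace H1

/-! ### The Hilbert space `H¹(a, b)` -/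

theorem deriv_ae {f : C.H1} {q : Ivl a b → ℂ} (hq : HasRN C.sigma f.fn q) :
    f.deriv =ᵐ[C.sigma] q :=
  f.hasRN.unique hq

theorem norm_sq_eq (f : C.H1) :
    ‖f‖ ^ 2 = (∫ x, ‖f.fn x‖ ^ 2 ∂C.chi) + ∫ x, ‖f.deriv x‖ ^ 2 ∂C.sigma := by
  rw [@norm_sq_eq_re_inner ℂ, inner_eq, innerProd_self]
  exact Complex.ofReal_re _

theorem integral_fn_sq_nonneg (f : C.H1) : 0 ≤ ∫ x, ‖f.fn x‖ ^ 2 ∂C.chi :=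
  integral_nonneg fun _ => sq_nonneg _

theorem integral_deriv_sq_nonneg (f : C.H1) : 0 ≤ ∫ x, ‖f.deriv x‖ ^ 2 ∂C.sigma :=
  integral_nonneg fun _ => sq_nonneg _

/-- Point evaluations are bounded on `H¹(a, b)`, locally uniformly. -/
theorem exists_norm_fn_le (c d : Ivl a b) :
    ∃ K, 0 ≤ K ∧ ∀ f : C.H1, ∀ x ∈ Icc c d, ‖f.fn x‖ ≤ K * ‖f‖ := by
  obtain ⟨c₀, d₀, h0⟩ := C.exists_chi_Ico_ne_zero
  -- The interval is enlarged until `χ` charges it, so that values of `f` can be averaged against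
  -- `χ`.
  set c' := min c c₀
  set d' := max d d₀
  set M := C.chi.real (Ico c' d')
  set S := C.sigma.real (Ico c' d')
  have hfin : C.chi (Ico c' d') ≠ ∞ := measure_Ico_ne_top _ _
  have hM : 0 < M := by
    refine ENNReal.toReal_pos (fun h => h0 ?_) hfin
    exact measure_mono_null (Ico_subset_Ico (min_le_right _ _) (le_max_right _ _)) h
  have hS : 0 ≤ S := measureReal_nonneg
  -- Integrate `|f x| ≤ |f y| + ∫ |f'| dς` over `y` with respect to `χ`, and bound both `L¹` norms
  -- through `|u| ≤ 1 + |u|²`. That bound is not homogeneous, hence the normalisation `‖f‖ ≤ 1`,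
  -- removed by scaling.
  have hunit : ∀ f : C.H1, ‖f‖ ≤ 1 → ∀ x ∈ Icc c d, ‖f.fn x‖ ≤ (M + 1) / M + (S + 1) := by
    intro f hf x hx
    have hsq : ‖f‖ ^ 2 ≤ 1 := pow_le_one₀ (norm_nonneg _) hf
    rw [norm_sq_eq] at hsq
    have n1 := f.integral_fn_sq_nonneg
    have n2 := f.integral_deriv_sq_nonneg
    have hx' : x ∈ Icc c' d' := ⟨(min_le_left _ _).trans hx.1, hx.2.trans (le_max_left _ _)⟩
    have b1 := setIntegral_norm_le f.memLp_fn c' d'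
    have b2 := setIntegral_norm_le f.memLp_deriv c' d'
    have iI : IntegrableOn (fun y => ‖f.fn y‖) (Ico c' d') C.chi :=
      (integrableOn_Ico f.locallyIntegrable_fn _ _).norm
    have key : ∫ y in Ico c' d', ‖f.fn x‖ ∂C.chi ≤ ∫ y in Ico c' d',
        (‖f.fn y‖ + ∫ t in Ico c' d', ‖f.deriv t‖ ∂C.sigma) ∂C.chi := by
      refine setIntegral_mono_on (integrableOn_const hfin) (iI.add (integrableOn_const hfin))
        measurableSet_Ico fun y hy => ?_
      exact f.hasRN.norm_le hx' (Ico_subset_Icc_self hy)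
    rw [integral_add iI (integrableOn_const hfin), setIntegral_const, setIntegral_const,
      smul_eq_mul, smul_eq_mul] at key
    change M * _ ≤ _ + M * _ at key
    have h1 : M * ‖f.fn x‖ ≤ (M + 1) + M * (S + 1) := by
      refine key.trans (add_le_add ?_ (mul_le_mul_of_nonneg_left ?_ hM.le))
      · linarith
      · linarith
    rw [← mul_le_mul_iff_right₀ hM]
    calc _ ≤ _ := h1
      _ = _ := by field_simp
  refine ⟨(M + 1) / M + (S + 1), by positivity, fun f x hx => ?_⟩
  rcases eq_or_ne f 0 with rfl | hf
  · simp [fn_zero]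
  · have hn : 0 < ‖f‖ := norm_pos_iff.2 hf
    have := hunit (((‖f‖⁻¹ : ℝ) : ℂ) • f) (by
      rw [norm_smul, Complex.norm_real, norm_inv, norm_norm, inv_mul_cancel₀ hn.ne']) x hx
    rw [fn_smul, Pi.smul_apply, norm_smul, Complex.norm_real, norm_inv, norm_norm,
      inv_mul_le_iff₀ hn] at this
    linarith

/-- Evaluation at a point. -/
noncomputable def eval (x : Ivl a b) : C.H1 →L[ℂ] ℂ :=
  LinearMap.mkContinuousOfExistsBound
    { toFun := fun f => f.fn x
      map_add' := fun _ _ => rfl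
      map_smul' := fun _ _ => rfl }
    ((exists_norm_fn_le (C := C) x x).imp fun _ hK f => hK.2 f x (left_mem_Icc.2 le_rfl))

/-- The embedding of `H¹(a, b)` into `L²((a, b); χ)`. -/
noncomputable def toLpFn : C.H1 →L[ℂ] Lp ℂ 2 C.chi :=
  LinearMap.mkContinuous
    { toFun := fun f => f.memLp_fn.toLp f.fn
      map_add' := fun f g => MemLp.toLp_add f.memLp_fn g.memLp_fn
      map_smul' := fun z f => MemLp.toLp_const_smul z f.memLp_fn } 1 fun f => by
    rw [one_mul]
    refine (sq_le_sq₀ (norm_nonneg _) (norm_nonneg _)).1 ?_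
    change ‖f.memLp_fn.toLp f.fn‖ ^ 2 ≤ _
    rw [norm_toLp_sq_eq_integral, norm_sq_eq]
    exact le_add_of_nonneg_right f.integral_deriv_sq_nonneg

/-- The Radon--Nikodym derivative as a map from `H¹(a, b)` into `L²((a, b); ς)`. -/
noncomputable def toLpDeriv : C.H1 →L[ℂ] Lp ℂ 2 C.sigma :=
  LinearMap.mkContinuous
    { toFun := fun f => f.memLp_deriv.toLp f.deriv
      map_add' := fun f g => (MemLp.toLp_congr _ (f.memLp_deriv.add g.memLp_deriv)
        (deriv_add f g)).trans (MemLp.toLp_add f.memLp_deriv g.memLp_deriv)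
      map_smul' := fun z f => (MemLp.toLp_congr _ (f.memLp_deriv.const_smul z)
        (deriv_smul z f)).trans (MemLp.toLp_const_smul z f.memLp_deriv) } 1 fun f => by
    rw [one_mul]
    refine (sq_le_sq₀ (norm_nonneg _) (norm_nonneg _)).1 ?_
    change ‖f.memLp_deriv.toLp f.deriv‖ ^ 2 ≤ _
    rw [norm_toLp_sq_eq_integral, norm_sq_eq]
    exact le_add_of_nonneg_left f.integral_fn_sq_nonneg

theorem toLpFn_ae (f : C.H1) : toLpFn f =ᵐ[C.chi] f.fn := f.memLp_fn.coeFn_toLp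

theorem toLpDeriv_ae (f : C.H1) : toLpDeriv f =ᵐ[C.sigma] f.deriv := f.memLp_deriv.coeFn_toLp

theorem norm_sq_eq_add (f : C.H1) : ‖f‖ ^ 2 = ‖toLpFn f‖ ^ 2 + ‖toLpDeriv f‖ ^ 2 := by
  rw [norm_sq_eq, ← norm_toLp_sq_eq_integral f.memLp_fn, ← norm_toLp_sq_eq_integral f.memLp_deriv]
  rfl

theorem tendsto_setIntegral_Ico {μ : Measure (Ivl a b)} [IsLocallyFiniteMeasure μ]
    {u : ℕ → Lp ℂ 2 μ} {G : Lp ℂ 2 μ} (hu : Tendsto u atTop (𝓝 G)) (c d : Ivl a b) :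
    Tendsto (fun n => ∫ t in Ico c d, u n t ∂μ) atTop (𝓝 (∫ t in Ico c d, G t ∂μ)) := by
  have hfin : μ (Ico c d) ≠ ∞ := measure_Ico_ne_top _ _
  simp only [← L2.inner_indicatorConstLp_one (𝕜 := ℂ) measurableSet_Ico hfin]
  exact tendsto_const_nhds.inner hu

/-- Along a Cauchy sequence the functions converge in `L²(χ)`, the derivatives in `L²(ς)`, and the
values at one point `c` in `ℂ`. The last two limits determine a primitive to which the sequence
converges pointwise. -/
instance : CompleteSpace C.H1 := by
  obtain ⟨c⟩ := C.nonempty_ivl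
  refine Metric.complete_of_cauchySeq_tendsto fun u hu => ?_
  obtain ⟨F, hF⟩ := cauchySeq_tendsto_of_complete (toLpFn.uniformContinuous.comp_cauchySeq hu)
  obtain ⟨G, hG⟩ := cauchySeq_tendsto_of_complete (toLpDeriv.uniformContinuous.comp_cauchySeq hu)
  obtain ⟨z, hz⟩ := cauchySeq_tendsto_of_complete ((eval c).uniformContinuous.comp_cauchySeq hu)
  have hloc : LocallyIntegrable G C.sigma := (Lp.memLp G).locallyIntegrable (by norm_num)
  have hRN := HasRN.oint hloc z c
  have hoint : ∀ x, Tendsto (fun n => oint C.sigma (u n).deriv c x) atTop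
      (𝓝 (oint C.sigma G c x)) := by
    intro x
    have e : ∀ (n : ℕ) (s : Set (Ivl a b)), ∫ t in s, (u n).deriv t ∂C.sigma =
        ∫ t in s, toLpDeriv (u n) t ∂C.sigma := fun n s =>
      integral_congr_ae (ae_restrict_of_ae (toLpDeriv_ae (u n)).symm)
    unfold oint
    split_ifs
    · simp only [e]
      exact tendsto_setIntegral_Ico hG _ _
    · simp only [e]
      exact (tendsto_setIntegral_Ico hG _ _).neg
  have hpt : ∀ x, Tendsto (fun n => (u n).fn x) atTop (𝓝 (z + oint C.sigma G c x)) := by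
    intro x
    refine (hz.add (hoint x)).congr fun n => ?_
    exact ((u n).hasRN.2 c x).symm
  -- An almost everywhere convergent subsequence identifies the `L²(χ)` limit with the pointwise
  -- one.
  obtain ⟨ns, hns, hae⟩ := (tendstoInMeasure_of_tendsto_Lp hF).exists_seq_tendsto_ae
  have hfF : (fun x => z + oint C.sigma G c x) =ᵐ[C.chi] F := by
    have hall : ∀ᵐ x ∂C.chi, ∀ n, toLpFn (u n) x = (u n).fn x :=
      ae_all_iff.2 fun n => toLpFn_ae (u n)
    filter_upwards [hae, hall] with x hx hx'
    refine tendsto_nhds_unique ((hpt x).comp hns.tendsto_atTop) (hx.congr fun i => ?_)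
    exact hx' _
  let f : C.H1 := ⟨fun x => z + oint C.sigma G c x, (memLp_congr_ae hfF).2 (Lp.memLp F), G, hRN,
    Lp.memLp G⟩
  have eF : toLpFn f = F := Lp.ext ((toLpFn_ae f).trans hfF)
  have eG : toLpDeriv f = G := Lp.ext ((toLpDeriv_ae f).trans (deriv_ae hRN))
  refine ⟨f, tendsto_iff_norm_sub_tendsto_zero.2 ?_⟩
  have h1 := tendsto_iff_norm_sub_tendsto_zero.1 hF
  have h2 := tendsto_iff_norm_sub_tendsto_zero.1 hG
  have h3 : Tendsto (fun n => ‖u n - f‖ ^ 2) atTop (𝓝 0) := by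
    have := (h1.pow 2).add (h2.pow 2)
    simp only [Function.comp_apply, ne_eq, OfNat.ofNat_ne_zero, not_false_eq_true, zero_pow,
      add_zero] at this
    refine this.congr fun n => ?_
    rw [norm_sq_eq_add, map_sub, map_sub, eF, eG]
  have h4 := h3.sqrt
  simpa using h4

end H1

end Coeff

/-! ### Derivatives of functions vanishing on a half-line. -/

section AC

variable {μ : Measure (Ivl a b)} {f g h k : Ivl a b → ℂ}

theorem HasRN.sub (hf : HasRN μ f h) (hg : HasRN μ g k) : HasRN μ (f - g) (h - k) := by
  convert hf.add (hg.smul (-1)) using 1 <;> simp [sub_eq_add_neg]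

/-- The point `α` is left out of the conclusion: an atom of `μ` there affects `f` only to the right
of `α`. -/
theorem HasRN.ae_eq_zero_of_Iic {α : Ivl a b} (hf : HasRN μ f h) (h0 : ∀ x ≤ α, f x = 0) :
    ∀ᵐ t ∂μ, t ∈ Iio α → h t = 0 := by
  have key : (Iio α).indicator h =ᵐ[μ] 0 := by
    refine ae_eq_zero_of_integral_Ico (hf.1.indicator measurableSet_Iio) fun c d => ?_
    rw [setIntegral_indicator measurableSet_Iio]
    have e : Ico c d ∩ Iio α = Ico c (min d α) := by
      ext t; simp
    rw [e]
    rcases le_total c (min d α) with hle | hle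
    · rw [← hf.sub_eq hle, h0 _ (min_le_right _ _), h0 _ (hle.trans (min_le_right _ _)), sub_zero]
    · simp [Ico_eq_empty hle.not_gt]
  filter_upwards [key] with t ht hta
  simpa [indicator_of_mem hta] using ht

theorem HasRN.ae_eq_zero_of_Ici {β : Ivl a b} (hf : HasRN μ f h) (h0 : ∀ x ≥ β, f x = 0) :
    ∀ᵐ t ∂μ, t ∈ Ici β → h t = 0 := by
  have key : (Ici β).indicator h =ᵐ[μ] 0 := by
    refine ae_eq_zero_of_integral_Ico (hf.1.indicator measurableSet_Ici) fun c d => ?_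
    rw [setIntegral_indicator measurableSet_Ici]
    have e : Ico c d ∩ Ici β = Ico (max c β) d := by
      ext t; simp only [mem_inter_iff, mem_Ico, mem_Ici, sup_le_iff]; tauto
    rw [e]
    rcases le_total (max c β) d with hle | hle
    · rw [← hf.sub_eq hle, h0 _ (le_max_right _ _), h0 _ ((le_max_right _ _).trans hle), sub_zero]
    · simp [Ico_eq_empty hle.not_gt]
  filter_upwards [key] with t ht hta
  simpa [indicator_of_mem hta] using ht

end AC

namespace Coeff

variable {C : Coeff a b}

namespace H1

/-! ### The bilinear form of `H¹(a, b)` on subsets -/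

/-- The complex conjugate of a function in `H¹(a, b)`. -/
noncomputable def conjugate (f : C.H1) : C.H1 :=
  ⟨fun x => conj (f.fn x), f.memLp_fn.star, fun x => conj (f.deriv x), f.hasRN.conj,
    f.memLp_deriv.star⟩

theorem fn_conjugate (f : C.H1) (x : Ivl a b) : f.conjugate.fn x = conj (f.fn x) := rfl

theorem deriv_conjugate (f : C.H1) :
    f.conjugate.deriv =ᵐ[C.sigma] fun x => conj (f.deriv x) :=
  deriv_ae (f := f.conjugate) f.hasRN.conj

theorem conjugate_conjugate (f : C.H1) : f.conjugate.conjugate = f :=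
  fn_injective (funext fun x => Complex.conj_conj (f.fn x))

/-- The bilinear form `∫_s f g dχ + ∫_s f' g' dς`. -/
noncomputable def bil (s : Set (Ivl a b)) (f g : C.H1) : ℂ :=
  (∫ x in s, f.fn x * g.fn x ∂C.chi) + ∫ x in s, f.deriv x * g.deriv x ∂C.sigma

theorem integrable_fn_mul (f g : C.H1) : Integrable (fun x => f.fn x * g.fn x) C.chi :=
  MemLp.integrable_mul (p := 2) (q := 2) f.memLp_fn g.memLp_fn

theorem integrable_deriv_mul (f g : C.H1) : Integrable (fun x => f.deriv x * g.deriv x) C.sigma :=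
  MemLp.integrable_mul (p := 2) (q := 2) f.memLp_deriv g.memLp_deriv

theorem bil_comm (s : Set (Ivl a b)) (f g : C.H1) : bil s f g = bil s g f := by
  simp only [bil, mul_comm]

theorem inner_eq_bil (f g : C.H1) : inner ℂ f g = bil univ f.conjugate g := by
  rw [inner_eq, innerProd, bil, setIntegral_univ, setIntegral_univ]
  congr 1
  refine integral_congr_ae ?_
  filter_upwards [f.deriv_conjugate] with x hx
  rw [hx]

theorem bil_Iio_add_bil_Ici (x : Ivl a b) (f g : C.H1) :
    bil (Iio x) f g + bil (Ici x) f g = bil univ f g := by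
  rw [bil, bil, bil, setIntegral_univ, setIntegral_univ, ← compl_Iio,
    ← integral_add_compl measurableSet_Iio (f.integrable_fn_mul g),
    ← integral_add_compl measurableSet_Iio (f.integrable_deriv_mul g)]
  ring

theorem bil_Ico_add_bil_Ici {x y : Ivl a b} (hxy : x ≤ y) (f g : C.H1) :
    bil (Ico x y) f g + bil (Ici y) f g = bil (Ici x) f g := by
  have hd : Disjoint (Ico x y) (Ici y) :=
    disjoint_left.2 fun t ht ht' => (ht.2.trans_le ht').false
  rw [bil, bil, bil, ← Ico_union_Ici_eq_Ici hxy,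
    setIntegral_union hd measurableSet_Ici (f.integrable_fn_mul g).integrableOn
      (f.integrable_fn_mul g).integrableOn,
    setIntegral_union hd measurableSet_Ici (f.integrable_deriv_mul g).integrableOn
      (f.integrable_deriv_mul g).integrableOn]
  ring

theorem bil_Iio_eq_zero {α : Ivl a b} {f : C.H1} (h0 : ∀ x ≤ α, f.fn x = 0) (g : C.H1) :
    bil (Iio α) f g = 0 := by
  rw [bil, setIntegral_eq_zero_of_forall_eq_zero, zero_add, integral_eq_zero_of_ae]
  · rw [EventuallyEq, ae_restrict_iff' measurableSet_Iio]
    filter_upwards [f.hasRN.ae_eq_zero_of_Iic h0] with t ht hta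
    simp [ht hta]
  · intro t ht
    rw [h0 t (le_of_lt ht), zero_mul]

theorem bil_Ici_eq_zero {β : Ivl a b} {f : C.H1} (h0 : ∀ x ≥ β, f.fn x = 0) (g : C.H1) :
    bil (Ici β) f g = 0 := by
  rw [bil, setIntegral_eq_zero_of_forall_eq_zero, zero_add, integral_eq_zero_of_ae]
  · rw [EventuallyEq, ae_restrict_iff' measurableSet_Ici]
    filter_upwards [f.hasRN.ae_eq_zero_of_Ici h0] with t ht hta
    simp [ht hta]
  · intro t ht
    rw [h0 t ht, zero_mul]

theorem tendsto_bil_atTop (x : Ivl a b) (f g : C.H1) :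
    Tendsto (fun y => bil (Ico x y) f g) atTop (𝓝 (bil (Ici x) f g)) := by
  have e : ∀ y, Ico x y ∩ Ici x = Ico x y := fun y => inter_eq_left.2 fun t ht => ht.1
  have key : ∀ {μ : Measure (Ivl a b)} {u : Ivl a b → ℂ}, Integrable u μ →
      Tendsto (fun y => ∫ t in Ico x y, u t ∂μ) atTop (𝓝 (∫ t in Ici x, u t ∂μ)) := by
    intro μ u hu
    have := (aecover_Ici_of_Ico (μ := μ) (B := x)
      (tendsto_id (α := Ivl a b) (x := atTop))).integral_tendsto_of_countably_generated
      hu.integrableOn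
    simpa only [Measure.restrict_restrict measurableSet_Ico, id, e] using this
  exact (key (f.integrable_fn_mul g)).add (key (f.integrable_deriv_mul g))

theorem tendsto_bil_atBot (y : Ivl a b) (f g : C.H1) :
    Tendsto (fun x => bil (Ico x y) f g) atBot (𝓝 (bil (Iio y) f g)) := by
  have e : ∀ x, Ici x ∩ Iio y = Ico x y := fun x => rfl
  have key : ∀ {μ : Measure (Ivl a b)} {u : Ivl a b → ℂ}, Integrable u μ →
      Tendsto (fun x => ∫ t in Ico x y, u t ∂μ) atBot (𝓝 (∫ t in Iio y, u t ∂μ)) := by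
    intro μ u hu
    have := (aecover_Ici (μ := μ.restrict (Iio y))
      (tendsto_id (α := Ivl a b) (x := atBot))).integral_tendsto_of_countably_generated
      hu.integrableOn
    simpa only [Measure.restrict_restrict measurableSet_Ici, id, e] using this
  exact (key (f.integrable_fn_mul g)).add (key (f.integrable_deriv_mul g))

theorem inner_eq_bil_Ico {φ : C.H1} {c d : Ivl a b} (hcd : c ≤ d) (hc : ∀ x ≤ c, φ.fn x = 0)
    (hd : ∀ x ≥ d, φ.fn x = 0) (g : C.H1) : inner ℂ φ g = bil (Ico c d) φ.conjugate g := by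
  rw [inner_eq_bil, ← bil_Iio_add_bil_Ici c, ← bil_Ico_add_bil_Ici hcd, bil_Iio_eq_zero,
    bil_Ici_eq_zero]
  · ring
  · intro x hx
    rw [fn_conjugate, hd x hx, map_zero]
  · intro x hx
    rw [fn_conjugate, hc x hx, map_zero]

end H1

/-! ### Green's formula -/

theorem isTau_of_mem_Tmax {p : C.H1 × C.H1} (hp : p ∈ C.Tmax) :
    C.IsTau p.1.fn (C.quasiDeriv p.1.fn) p.2.fn := by
  obtain ⟨-, -, q, hq⟩ := hp
  change C.IsTau p.1.fn q p.2.fn at hq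
  rwa [hq.quasiDeriv_eq]

theorem mem_Tmax_of_isTau {u v : C.H1} {q : Ivl a b → ℂ} (h : C.IsTau u.fn q v.fn) :
    (u, v) ∈ C.Tmax :=
  ⟨⟨_, u.hasRN⟩, ⟨_, v.hasRN⟩, q, h⟩

/-- This is `ibp` with `Q = f^{[1]}`, which is a representative of `df/dς`. -/
theorem green {p : C.H1 × C.H1} (hp : p ∈ C.Tmax) (φ : C.H1) {x y : Ivl a b} (hxy : x ≤ y) :
    φ.fn y * C.quasiDeriv p.1.fn y - φ.fn x * C.quasiDeriv p.1.fn x =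
      H1.bil (Ico x y) φ p.1 - C.rho.oint (fun t => φ.fn t * p.2.fn t) x y := by
  have h := isTau_of_mem_Tmax hp
  rw [ibp φ.hasRN (p.1.locallyIntegrable_fn) (p.2.hasRN.locallyIntegrable) h.quasi_eq hxy, H1.bil]
  congr 2
  refine integral_congr_ae (ae_restrict_of_ae ?_)
  filter_upwards [H1.deriv_ae h.1] with t ht
  rw [ht]

/-- The Lagrange identity: both applications of `green` contain the same integral `∫ f_τ g_τ dϱ`,
which cancels. -/
theorem V_sub_V {f g : C.H1 × C.H1} (hf : f ∈ C.Tmax) (hg : g ∈ C.Tmax) {x y : Ivl a b}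
    (hxy : x ≤ y) : C.V (C.fnPair f) (C.fnPair g) y - C.V (C.fnPair f) (C.fnPair g) x =
      H1.bil (Ico x y) f.2 g.1 - H1.bil (Ico x y) f.1 g.2 := by
  have e1 := green hg f.2 hxy
  have e2 := green hf g.2 hxy
  simp only [mul_comm (g.2.fn _)] at e2
  rw [H1.bil_comm _ g.2] at e2
  simp only [V, fnPair]
  linear_combination e1 - e2

theorem tendsto_V_atTop {f g : C.H1 × C.H1} (hf : f ∈ C.Tmax) (hg : g ∈ C.Tmax) (x : Ivl a b) :
    Tendsto (C.V (C.fnPair f) (C.fnPair g)) atTop (𝓝 (C.V (C.fnPair f) (C.fnPair g) x +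
      (H1.bil (Ici x) f.2 g.1 - H1.bil (Ici x) f.1 g.2))) := by
  refine Tendsto.congr' ?_ (((H1.tendsto_bil_atTop x f.2 g.1).sub
    (H1.tendsto_bil_atTop x f.1 g.2)).const_add _)
  filter_upwards [eventually_ge_atTop x] with y hy
  rw [← V_sub_V hf hg hy, add_sub_cancel]

theorem tendsto_V_atBot {f g : C.H1 × C.H1} (hf : f ∈ C.Tmax) (hg : g ∈ C.Tmax) (y : Ivl a b) :
    Tendsto (C.V (C.fnPair f) (C.fnPair g)) atBot (𝓝 (C.V (C.fnPair f) (C.fnPair g) y -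
      (H1.bil (Iio y) f.2 g.1 - H1.bil (Iio y) f.1 g.2))) := by
  refine Tendsto.congr' ?_ (((H1.tendsto_bil_atBot y f.2 g.1).sub
    (H1.tendsto_bil_atBot y f.1 g.2)).const_sub _)
  filter_upwards [eventually_le_atBot y] with x hx
  rw [← V_sub_V hf hg hx, sub_sub_cancel]

theorem tendsto_V_atTop_of_atBot {f g : C.H1 × C.H1} (hf : f ∈ C.Tmax) (hg : g ∈ C.Tmax) {l : ℂ}
    (hl : Tendsto (C.V (C.fnPair f) (C.fnPair g)) atBot (𝓝 l)) :
    Tendsto (C.V (C.fnPair f) (C.fnPair g)) atTop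
      (𝓝 (l + (H1.bil univ f.2 g.1 - H1.bil univ f.1 g.2))) := by
  obtain ⟨c⟩ := C.nonempty_ivl
  have : Nonempty (Ivl a b) := ⟨c⟩
  rw [tendsto_nhds_unique hl (tendsto_V_atBot hf hg c)]
  convert tendsto_V_atTop hf hg c using 2
  rw [← H1.bil_Iio_add_bil_Ici c, ← H1.bil_Iio_add_bil_Ici c f.1]
  ring

/-- The pointwise conjugate of a pair in `T_max`. -/
noncomputable def conjPair (p : C.H1 × C.H1) : C.H1 × C.H1 := (p.1.conjugate, p.2.conjugate)

theorem conjPair_mem_Tmax {p : C.H1 × C.H1} (hp : p ∈ C.Tmax) : conjPair p ∈ C.Tmax :=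
  mem_Tmax_of_isTau (isTau_of_mem_Tmax hp).conj

/-! ### The weak form of the differential equation -/

/-- Boundedness comes from the uniform bound on point evaluations over `[c, d]`. These functionals
give closedness of the weak conditions and the input for the Riesz theorem. -/
theorem exists_oint_functional {k : Ivl a b → ℂ} (hk : LocallyIntegrable k C.rho.variation)
    {c d : Ivl a b} (hcd : c ≤ d) :
    ∃ L : C.H1 →L[ℂ] ℂ, ∀ ψ : C.H1, L ψ = C.rho.oint (fun t => k t * ψ.fn t) c d := by
  obtain ⟨K, hK0, hK⟩ := H1.exists_norm_fn_le (C := C) c d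
  have hloc : ∀ ψ : C.H1, LocallyIntegrable (fun t => k t * ψ.fn t) C.rho.variation := fun ψ => by
    simpa only [mul_comm] using ψ.hasRN.locallyIntegrable_mul hk
  refine ⟨LinearMap.mkContinuous
    { toFun := fun ψ => C.rho.oint (fun t => k t * ψ.fn t) c d
      map_add' := fun ψ₁ ψ₂ => ?_
      map_smul' := fun z ψ => ?_ } (K * ∫ t in Ico c d, ‖k t‖ ∂C.rho.variation)
      fun ψ => ?_, fun ψ => rfl⟩
  · rw [← RealMeasure.oint_add (hloc ψ₁) (hloc ψ₂)]
    congr 1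
    funext t
    exact mul_add _ _ _
  · change _ = z * _
    rw [← RealMeasure.oint_smul]
    congr 1
    funext t
    exact mul_left_comm _ _ _
  · refine (RealMeasure.norm_oint_le (hloc ψ) hcd).trans ?_
    rw [mul_right_comm, ← integral_const_mul]
    refine setIntegral_mono_on (integrableOn_Ico (hloc ψ) c d).norm
      ((integrableOn_Ico hk c d).norm.const_mul _) measurableSet_Ico fun t ht => ?_
    rw [norm_mul, mul_comm]
    exact mul_le_mul_of_nonneg_right (hK ψ t (Ico_subset_Icc_self ht)) (norm_nonneg _)

/-- The boundary terms in `green` vanish because `φ` is zero at `c` and at `d`. -/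
theorem inner_eq_oint_of_mem_Tmax {p : C.H1 × C.H1} (hp : p ∈ C.Tmax) {φ : C.H1} {c d : Ivl a b}
    (hcd : c ≤ d) (hc : ∀ x ≤ c, φ.fn x = 0) (hd : ∀ x ≥ d, φ.fn x = 0) :
    inner ℂ φ p.1 = C.rho.oint (fun t => conj (φ.fn t) * p.2.fn t) c d := by
  have e := green hp φ.conjugate hcd
  rw [H1.fn_conjugate, H1.fn_conjugate, hc c le_rfl, hd d le_rfl] at e
  rw [H1.inner_eq_bil_Ico hcd hc hd]
  simp only [H1.fn_conjugate, map_zero, zero_mul, sub_zero] at e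
  exact (sub_eq_zero.1 e.symm)

end Coeff

/-! ### Compactly supported test functions and regularity of weak solutions. -/

theorem memLp_indicator_Ico_of_bound {μ : Measure (Ivl a b)} [IsLocallyFiniteMeasure μ]
    {u : Ivl a b → ℂ} (hu : StronglyMeasurable u) {c d : Ivl a b} {K : ℝ}
    (hK : ∀ x ∈ Ico c d, ‖u x‖ ≤ K) : MemLp ((Ico c d).indicator u) 2 μ := by
  rw [memLp_indicator_iff_restrict measurableSet_Ico]
  have : IsFiniteMeasure (μ.restrict (Ico c d)) :=
    ⟨by rw [Measure.restrict_apply_univ]; exact (measure_Ico_ne_top c d).lt_top⟩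
  refine MemLp.of_bound hu.aestronglyMeasurable K ?_
  filter_upwards [ae_restrict_mem measurableSet_Ico] with t ht using hK t ht

theorem oint_indicator_of_le {μ : Measure (Ivl a b)} (h : Ivl a b → ℂ) {c d x : Ivl a b}
    (hx : x ≤ c) : oint μ ((Ico c d).indicator h) c x = 0 := by
  rw [oint_symm x c, oint_of_le hx, setIntegral_indicator measurableSet_Ico]
  have : Ico x c ∩ Ico c d = ∅ := by
    ext t; simp only [mem_inter_iff, mem_Ico, mem_empty_iff_false, iff_false]
    exact fun ht => (ht.1.2.trans_le ht.2.1).false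
  simp [this]

theorem oint_indicator_of_ge {μ : Measure (Ivl a b)} (h : Ivl a b → ℂ) {c d x : Ivl a b}
    (hcd : c ≤ d) (hx : d ≤ x) :
    oint μ ((Ico c d).indicator h) c x = ∫ t in Ico c d, h t ∂μ := by
  rw [oint_of_le (hcd.trans hx), setIntegral_indicator measurableSet_Ico,
    inter_eq_right.2 (Ico_subset_Ico_right hx)]

namespace Coeff

variable {C : Coeff a b}

/-- A square integrable function on `[c, d)` with vanishing integral is the derivative of an element
of `H¹(a, b)` that vanishes outside of this interval. -/
theorem exists_H1_of_integral_eq_zero {r : Ivl a b → ℂ} {c d : Ivl a b} (hcd : c ≤ d)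
    (hr : MemLp ((Ico c d).indicator r) 2 C.sigma) (h0 : ∫ t in Ico c d, r t ∂C.sigma = 0) :
    ∃ φ : C.H1, (∀ x ≤ c, φ.fn x = 0) ∧ (∀ x ≥ d, φ.fn x = 0) ∧
      HasRN C.sigma φ.fn ((Ico c d).indicator r) := by
  have hRN := HasRN.oint (hr.locallyIntegrable (by norm_num)) 0 c
  set φ := fun x => 0 + oint C.sigma ((Ico c d).indicator r) c x
  have hl : ∀ x ≤ c, φ x = 0 := fun x hx => by simp [φ, oint_indicator_of_le _ hx]
  have hg : ∀ x ≥ d, φ x = 0 := fun x hx => by simp [φ, oint_indicator_of_ge _ hcd hx, h0]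
  obtain ⟨K, hK⟩ := hRN.exists_bound c d
  have hφ : (Ico c d).indicator φ = φ := by
    refine indicator_eq_self.2 fun x hx => ?_
    refine ⟨le_of_not_ge fun hle => hx (hl x hle), lt_of_not_ge fun hle => hx (hg x hle)⟩
  refine ⟨⟨φ, ?_, _, hRN, hr⟩, hl, hg, hRN⟩
  rw [← hφ]
  exact memLp_indicator_Ico_of_bound hRN.stronglyMeasurable
    fun x hx => hK x (Ico_subset_Icc_self hx)

/-- The fundamental lemma of the calculus of variations, on a compact interval. -/
theorem exists_ae_eq_const_of_weak {u v : C.H1} {α β : Ivl a b} (hαβ : α ≤ β)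
    (hw : ∀ φ : C.H1, (∀ x ≤ α, φ.fn x = 0) → (∀ x ≥ β, φ.fn x = 0) →
      inner ℂ φ u = C.rho.oint (fun t => conj (φ.fn t) * v.fn t) α β)
    {Q : Ivl a b → ℂ} (hQm : StronglyMeasurable Q)
    (hQb : ∃ K, ∀ x ∈ Ico α β, ‖Q x‖ ≤ K)
    (hQ : ∀ c x, Q x = Q c + (oint C.chi u.fn c x - C.rho.oint v.fn c x)) :
    ∃ m : ℂ, ∀ᵐ t ∂C.sigma, t ∈ Ico α β → u.deriv t - Q t = m := by
  set I := Ico α β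
  rcases eq_or_ne (C.sigma I) 0 with hI0 | hI0
  · refine ⟨0, ?_⟩
    filter_upwards [measure_eq_zero_iff_ae_notMem.1 hI0] with t ht ht' using absurd ht' ht
  set w := fun t => u.deriv t - Q t
  have hfin := measure_Ico_ne_top (μ := C.sigma) α β
  obtain ⟨K, hK⟩ := hQb
  have wL : MemLp (I.indicator w) 2 C.sigma := by
    have := (u.memLp_deriv.indicator (measurableSet_Ico (a := α) (b := β))).sub
      (memLp_indicator_Ico_of_bound (μ := C.sigma) hQm hK)
    convert this using 1
    exact indicator_sub' _ _ _
  have iw : IntegrableOn w I C.sigma :=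
    (integrableOn_congr_fun (fun t ht => indicator_of_mem ht w) measurableSet_Ico).1
      (integrableOn_Ico (wL.locallyIntegrable (by norm_num)) α β)
  -- `m` is the `ς`-mean of `w`, so `r = w - m` has integral zero and is the derivative of an
  -- admissible test function.
  set m : ℂ := (C.sigma.real I : ℂ)⁻¹ * ∫ t in I, w t ∂C.sigma
  set r := fun t => w t - m
  have rL : MemLp (I.indicator r) 2 C.sigma := by
    have := wL.sub (memLp_indicator_const 2 (measurableSet_Ico (a := α) (b := β)) m (Or.inr hfin))
    convert this using 1
    exact indicator_sub' _ _ _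
  have r0 : ∫ t in I, r t ∂C.sigma = 0 := by
    rw [integral_sub iw (integrableOn_const hfin), setIntegral_const, Complex.real_smul]
    have : (C.sigma.real I : ℂ) ≠ 0 :=
      Complex.ofReal_ne_zero.2 (ENNReal.toReal_ne_zero.2 ⟨hI0, hfin⟩)
    field_simp [m]
    simp [m, mul_inv_cancel_left₀ this]
  obtain ⟨φ, hφα, hφβ, hφ⟩ := exists_H1_of_integral_eq_zero hαβ rL r0
  have e1 := hw φ hφα hφβ
  rw [H1.inner_eq_bil_Ico hαβ hφα hφβ, H1.bil] at e1
  have e2 := ibp hφ.conj (u.locallyIntegrable_fn) (v.hasRN.locallyIntegrable) hQ hαβ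
  simp only [hφα α le_rfl, hφβ β le_rfl, map_zero, zero_mul, sub_zero] at e2
  have e3 : ∫ t in I, φ.conjugate.deriv t * u.deriv t ∂C.sigma =
      ∫ t in I, conj (I.indicator r t) * u.deriv t ∂C.sigma := by
    refine integral_congr_ae (ae_restrict_of_ae ?_)
    filter_upwards [φ.deriv_conjugate, H1.deriv_ae hφ] with t h1 h2
    rw [h1, h2]
  simp only [H1.fn_conjugate] at e1
  rw [e3] at e1
  have rLr : MemLp r 2 (C.sigma.restrict I) := (memLp_indicator_iff_restrict measurableSet_Ico).1 rL
  have uLr : MemLp u.deriv 2 (C.sigma.restrict I) := u.memLp_deriv.restrict I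
  have QLr : MemLp Q 2 (C.sigma.restrict I) := (memLp_indicator_iff_restrict measurableSet_Ico).1
    (memLp_indicator_Ico_of_bound (μ := C.sigma) hQm hK)
  have e4 : ∀ k : Ivl a b → ℂ, ∫ t in I, conj (I.indicator r t) * k t ∂C.sigma =
      ∫ t in I, conj (r t) * k t ∂C.sigma := fun k =>
    setIntegral_congr_fun measurableSet_Ico fun t ht => by
      simp only [indicator_of_mem ht]
  -- The weak equation for `φ` together with integration by parts makes `r` orthogonal to `w`; it is
  -- orthogonal to constants by construction, hence to itself.
  have e5 : ∫ t in I, conj (r t) * r t ∂C.sigma = 0 := by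
    have e6 : ∀ t, conj (r t) * r t =
        conj (r t) * u.deriv t - conj (r t) * Q t - conj (r t) * m := fun t => by
      simp only [r, w]; ring
    simp only [e6]
    rw [integral_sub, integral_sub, integral_mul_const, integral_conj, r0, map_zero, zero_mul,
      sub_zero, ← e4, ← e4]
    · linear_combination e1 + e2
    · exact H1.integrable_conj_mul rLr uLr
    · exact H1.integrable_conj_mul rLr QLr
    · exact (H1.integrable_conj_mul rLr uLr).sub (H1.integrable_conj_mul rLr QLr)
    · have : IsFiniteMeasure (C.sigma.restrict I) :=
        ⟨by rw [Measure.restrict_apply_univ]; exact hfin.lt_top⟩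
      exact H1.integrable_conj_mul rLr (memLp_const m)
  rw [H1.integral_conj_mul_self, Complex.ofReal_eq_zero] at e5
  have e7 := H1.ae_zero_of_integral rLr e5
  rw [EventuallyEq, ae_restrict_iff' measurableSet_Ico] at e7
  refine ⟨m, ?_⟩
  filter_upwards [e7] with t ht htI
  exact sub_eq_zero.1 (ht htI)

/-- A weak solution of `τ u = v` is a solution. -/
theorem mem_Tmax_of_weak {u v : C.H1}
    (hw : ∀ (c d : Ivl a b) (φ : C.H1), c ≤ d → (∀ x ≤ c, φ.fn x = 0) → (∀ x ≥ d, φ.fn x = 0) →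
      inner ℂ φ u = C.rho.oint (fun t => conj (φ.fn t) * v.fn t) c d) : (u, v) ∈ C.Tmax := by
  obtain ⟨o⟩ := C.nonempty_ivl
  have lu := u.locallyIntegrable_fn
  have lv := v.hasRN.locallyIntegrable (ν := C.rho.variation)
  have hA := HasRN.oint lu 0 o
  have hP := HasRN.oint (RealMeasure.locallyIntegrable_pos lv) 0 o
  have hN := HasRN.oint (RealMeasure.locallyIntegrable_neg lv) 0 o
  set Q : Ivl a b → ℂ := fun x => (0 + oint C.chi u.fn o x) -
    ((0 + oint C.rho.pos v.fn o x) - (0 + oint C.rho.neg v.fn o x)) with hQdef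
  have hQm : StronglyMeasurable Q :=
    hA.stronglyMeasurable.sub (hP.stronglyMeasurable.sub hN.stronglyMeasurable)
  have hQb : ∀ α β, ∃ K, ∀ x ∈ Ico α β, ‖Q x‖ ≤ K := by
    intro α β
    obtain ⟨K₁, h₁⟩ := hA.exists_bound α β
    obtain ⟨K₂, h₂⟩ := hP.exists_bound α β
    obtain ⟨K₃, h₃⟩ := hN.exists_bound α β
    refine ⟨K₁ + (K₂ + K₃), fun x hx => ?_⟩
    have hx' := Ico_subset_Icc_self hx
    exact (norm_sub_le _ _).trans (add_le_add (h₁ x hx')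
      ((norm_sub_le _ _).trans (add_le_add (h₂ x hx') (h₃ x hx'))))
  have hQ : ∀ c x, Q x = Q c + (oint C.chi u.fn c x - C.rho.oint v.fn c x) := by
    intro c x
    have e1 := hA.2 c x
    have e2 := hP.2 c x
    have e3 := hN.2 c x
    rw [RealMeasure.oint, hQdef]
    linear_combination e1 - e2 + e3
  have hm := fun α β (hαβ : α ≤ β) => exists_ae_eq_const_of_weak hαβ
    (fun φ => hw α β φ hαβ) hQm (hQb α β) hQ
  obtain ⟨o', ho⟩ := exists_gt o
  obtain ⟨m, hm₀⟩ := hm o o' ho.le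
  -- The constant does not depend on the interval: every interval is enlarged to contain the
  -- reference interval `[o, o')`, which has positive `ς`-measure.
  have hmm : ∀ c d, ∀ᵐ t ∂C.sigma, t ∈ Ico c d → u.deriv t - Q t = m := by
    intro c d
    obtain ⟨m', hm'⟩ := hm (min c o) (max d o')
      ((min_le_right _ _).trans (ho.le.trans (le_max_right _ _)))
    have : m' = m := by
      by_contra hne
      refine C.sigma_Ico_ne_zero ho (measure_eq_zero_iff_ae_notMem.2 ?_)
      filter_upwards [hm₀, hm'] with t h1 h2 ht
      exact hne ((h2 (Ico_subset_Ico (min_le_right _ _) (le_max_right _ _) ht)).symm.trans (h1 ht))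
    subst this
    filter_upwards [hm'] with t ht htI
    exact ht (Ico_subset_Ico (min_le_left _ _) (le_max_left _ _) htI)
  have hae : u.deriv =ᵐ[C.sigma] fun t => Q t + m := by
    refine measure_null_of_locally_null _ fun x _ => ?_
    obtain ⟨c, hc⟩ := exists_lt x
    obtain ⟨d, hd⟩ := exists_gt x
    refine ⟨{t | u.deriv t ≠ Q t + m} ∩ Ico c d,
      inter_mem_nhdsWithin _ (Ico_mem_nhds hc hd), ?_⟩
    refine measure_mono_null ?_ (hmm c d)
    intro t ht hcon
    exact ht.1 (by linear_combination hcon ht.2)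
  refine mem_Tmax_of_isTau (isTau_of_quasi_eq (u.hasRN.congr hae) lv fun c x => ?_)
  rw [hQ c x]
  ring

theorem mem_Tmax_iff_weak {p : C.H1 × C.H1} :
    p ∈ C.Tmax ↔ ∀ (c d : Ivl a b) (φ : C.H1), c ≤ d → (∀ x ≤ c, φ.fn x = 0) →
      (∀ x ≥ d, φ.fn x = 0) →
      inner ℂ φ p.1 = C.rho.oint (fun t => conj (φ.fn t) * p.2.fn t) c d :=
  ⟨fun hp _ _ _ => inner_eq_oint_of_mem_Tmax hp, mem_Tmax_of_weak⟩

/-- The weak form exhibits the relation as an intersection of sets on which two continuous functions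
agree. -/
theorem isClosed_Tmax : IsClosed (C.Tmax : Set (C.H1 × C.H1)) := by
  have : (C.Tmax : Set (C.H1 × C.H1)) = ⋂ (c : Ivl a b) (d : Ivl a b) (φ : C.H1) (_ : c ≤ d)
      (_ : ∀ x ≤ c, φ.fn x = 0) (_ : ∀ x ≥ d, φ.fn x = 0),
      {p | inner ℂ φ p.1 = C.rho.oint (fun t => conj (φ.fn t) * p.2.fn t) c d} := by
    ext p
    simp only [SetLike.mem_coe, mem_iInter, mem_ofPred_eq]
    exact mem_Tmax_iff_weak
  rw [this]
  refine isClosed_iInter fun c => isClosed_iInter fun d => isClosed_iInter fun φ =>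
    isClosed_iInter fun hcd => isClosed_iInter fun _ => isClosed_iInter fun _ => ?_
  obtain ⟨L, hL⟩ := exists_oint_functional
    (φ.conjugate.hasRN.locallyIntegrable (ν := C.rho.variation)) hcd
  have : {p : C.H1 × C.H1 | inner ℂ φ p.1 =
      C.rho.oint (fun t => conj (φ.fn t) * p.2.fn t) c d} = {p | inner ℂ φ p.1 = L p.2} := by
    ext p
    rw [mem_ofPred_eq, mem_ofPred_eq, hL]
    rfl
  rw [this]
  exact isClosed_eq (continuous_const.inner continuous_fst) (L.continuous.comp continuous_snd)

end Coeff

/-! ### Integrals of compactly supported functions. -/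

theorem RealMeasure.oint_eq_of_subset {ρ : RealMeasure a b} {F : Ivl a b → ℂ}
    (hF : LocallyIntegrable F ρ.variation) {c d c' d' : Ivl a b} (hc' : c' ≤ c)
    (hd' : d ≤ d') (hc : ∀ x < c, F x = 0) (hd : ∀ x ≥ d, F x = 0) :
    ρ.oint F c' d' = ρ.oint F c d := by
  rw [← oint_add_adjacent hF c' d d', ← oint_add_adjacent hF c' c d,
    oint_eq_zero hc' fun t ht => hc t ht.2, oint_eq_zero hd' fun t ht => hd t ht.1, zero_add,
    add_zero]

theorem RealMeasure.oint_eq_of_support {ρ : RealMeasure a b} {F : Ivl a b → ℂ}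
    (hF : LocallyIntegrable F ρ.variation) {c d c' d' : Ivl a b}
    (hc : ∀ x < c, F x = 0) (hd : ∀ x ≥ d, F x = 0) (hc' : ∀ x < c', F x = 0)
    (hd' : ∀ x ≥ d', F x = 0) : ρ.oint F c d = ρ.oint F c' d' := by
  rw [← oint_eq_of_subset hF (min_le_left c c') (le_max_left d d') hc hd,
    ← oint_eq_of_subset hF (min_le_right c c') (le_max_right d d') hc' hd']

namespace Coeff

variable {C : Coeff a b}

/-! ### Cutting off functions in `H¹(a, b)` -/

/-- The profile `E` is `1` up to `α` and has constant derivative `-1 / ς([α, β))` on `[α, β)`, so it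
reaches `0` at `β`. The cut function depends linearly on `f`, through its values up to `α` only. -/
theorem exists_cut_apply {α β : Ivl a b} (hαβ : α < β) :
    ∃ E : Ivl a b → ℂ, (∀ x ≥ β, E x = 0) ∧ ∀ f : C.H1, ∃ g : C.H1,
      ∀ x, g.fn x = if x ≤ α then f.fn x else f.fn α * E x := by
  set S : ℂ := (C.sigma.real (Ico α β) : ℂ)
  have hfin := measure_Ico_ne_top (μ := C.sigma) α β
  have hS : S ≠ 0 := Complex.ofReal_ne_zero.2
    (ENNReal.toReal_ne_zero.2 ⟨C.sigma_Ico_ne_zero hαβ, hfin⟩)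
  set e : Ivl a b → ℂ := (Ico α β).indicator fun _ => -S⁻¹
  have eL : MemLp e 2 C.sigma := memLp_indicator_const 2 measurableSet_Ico _ (Or.inr hfin)
  have hE := HasRN.oint (eL.locallyIntegrable (by norm_num)) 1 α
  set E : Ivl a b → ℂ := fun x => 1 + oint C.sigma e α x
  have hEα : ∀ x ≤ α, E x = 1 := fun x hx => by simp [E, e, oint_indicator_of_le _ hx]
  have hEβ : ∀ x ≥ β, E x = 0 := fun x hx => by
    simp only [E, e]
    rw [oint_indicator_of_ge _ hαβ.le hx, setIntegral_const, Complex.real_smul]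
    change 1 + S * -S⁻¹ = 0
    rw [mul_neg, mul_inv_cancel₀ hS, add_neg_cancel]
  refine ⟨E, hEβ, fun f => ?_⟩
  set k := (Iio α).indicator f.deriv
  have kL : MemLp k 2 C.sigma := f.memLp_deriv.indicator measurableSet_Iio
  have hk := HasRN.oint (kL.locallyIntegrable (by norm_num)) 0 α
  have hRN := hk.add (hE.smul (f.fn α))
  have hF : ∀ x, ((fun x => 0 + oint C.sigma k α x) + f.fn α • E) x =
      if x ≤ α then f.fn x else f.fn α * E x := by
    intro x
    simp only [Pi.add_apply, Pi.smul_apply, smul_eq_mul]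
    split_ifs with hx
    · rw [hEα x hx, oint_symm x α, oint_of_le hx, setIntegral_indicator measurableSet_Iio]
      have : Ico x α ∩ Iio α = Ico x α := inter_eq_left.2 fun t ht => ht.2
      rw [this, ← f.hasRN.sub_eq hx]
      ring
    · rw [oint_of_le (le_of_not_ge hx), setIntegral_indicator measurableSet_Iio]
      have : Ico α x ∩ Iio α = ∅ := by
        ext t
        simp only [mem_inter_iff, mem_Ico, mem_Iio, mem_empty_iff_false, iff_false]
        exact fun ht => (ht.1.1.trans_lt ht.2).false
      simp [this]
  set F := (fun x => 0 + oint C.sigma k α x) + f.fn α • E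
  obtain ⟨K, hK⟩ := hRN.exists_bound α β
  have hL : MemLp F 2 C.chi := by
    have := (f.memLp_fn.indicator (measurableSet_Iio (a := α))).add
      (memLp_indicator_Ico_of_bound (μ := C.chi) hRN.stronglyMeasurable
        fun x hx => hK x (Ico_subset_Icc_self hx))
    convert this using 1
    funext x
    rw [Pi.add_apply]
    rcases lt_or_ge x α with hx | hx
    · rw [indicator_of_mem (show x ∈ Iio α from hx), indicator_of_notMem, hF, if_pos hx.le,
        add_zero]
      exact fun h => (h.1.trans_lt hx).false
    · rw [indicator_of_notMem (fun h : x ∈ Iio α => (hx.trans_lt h).false), zero_add]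
      rcases lt_or_ge x β with hx' | hx'
      · rw [indicator_of_mem (show x ∈ Ico α β from ⟨hx, hx'⟩)]
      · rw [indicator_of_notMem (fun h : x ∈ Ico α β => (hx'.trans_lt h.2).false), hF,
          if_neg (hαβ.trans_le hx').not_ge, hEβ x hx', mul_zero]
  exact ⟨⟨F, hL, _, hRN, kL.add (eL.const_smul _)⟩, hF⟩

/-- There is a bounded operator on `H¹(a, b)` which does not change functions on the left of `α`
and makes them vanish on the right of `β`. -/
theorem exists_cut {α β : Ivl a b} (hαβ : α < β) :
    ∃ K : C.H1 →L[ℂ] C.H1, ∀ f : C.H1, (∀ x ≤ α, (K f).fn x = f.fn x) ∧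
      ∀ x ≥ β, (K f).fn x = 0 := by
  obtain ⟨E, hE, hcut⟩ := exists_cut_apply (C := C) hαβ
  choose T hT using hcut
  let K : C.H1 →ₗ[ℂ] C.H1 :=
    { toFun := T
      map_add' := fun f g => H1.fn_injective <| funext fun x => by
        rw [H1.fn_add, Pi.add_apply, hT, hT, hT, H1.fn_add, Pi.add_apply, Pi.add_apply]
        split_ifs <;> ring
      map_smul' := fun z f => H1.fn_injective <| funext fun x => by
        rw [RingHom.id_apply, H1.fn_smul, Pi.smul_apply, hT, hT, H1.fn_smul, Pi.smul_apply,
          Pi.smul_apply, smul_eq_mul, smul_eq_mul, smul_eq_mul]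
        split_ifs <;> ring }
  -- By the closed graph theorem it suffices to identify limits pointwise, where continuity of
  -- evaluations applies.
  have hcont : Continuous K := by
    refine LinearMap.continuous_of_seq_closed_graph K fun u f g hu hg => ?_
    refine H1.fn_injective (funext fun x => ?_)
    have ev : ∀ {v : ℕ → C.H1} {w : C.H1}, Tendsto v atTop (𝓝 w) → ∀ x,
        Tendsto (fun n => (v n).fn x) atTop (𝓝 (w.fn x)) := fun {v w} h x =>
      ((H1.eval x).continuous.tendsto w).comp h
    have h1 := ev hg x
    refine tendsto_nhds_unique h1 ?_
    change Tendsto (fun n => (T (u n)).fn x) atTop (𝓝 ((T f).fn x))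
    simp only [hT]
    split_ifs
    · exact ev hu x
    · exact (ev hu α).mul_const _
  refine ⟨⟨K, hcont⟩, fun f => ⟨fun x hx => ?_, fun x hx => ?_⟩⟩
  · exact (hT f x).trans (if_pos hx)
  · exact (hT f x).trans (by rw [if_neg (hαβ.trans_le hx).not_ge, hE x hx, mul_zero])

/-! ### The adjoint of the maximal relation -/

/-- The Riesz theorem; conjugating the representer turns the sesquilinear pairing into the bilinear
one. -/
theorem exists_forall_bil_eq (L : C.H1 →L[ℂ] ℂ) :
    ∃ h : C.H1, ∀ ψ : C.H1, H1.bil univ h ψ = L ψ := by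
  refine ⟨((InnerProductSpace.toDual ℂ C.H1).symm L).conjugate, fun ψ => ?_⟩
  rw [← H1.inner_eq_bil, InnerProductSpace.toDual_symm_apply]

theorem bil_eq_oint_of_mem_Tmax {p : C.H1 × C.H1} (hp : p ∈ C.Tmax) {ψ : C.H1} {c d : Ivl a b}
    (hcd : c ≤ d) (hc : ∀ x ≤ c, ψ.fn x = 0) (hd : ∀ x ≥ d, ψ.fn x = 0) :
    H1.bil univ ψ p.1 = C.rho.oint (fun t => ψ.fn t * p.2.fn t) c d := by
  have := inner_eq_oint_of_mem_Tmax hp (φ := ψ.conjugate) hcd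
    (fun x hx => by rw [H1.fn_conjugate, hc x hx, map_zero])
    (fun x hx => by rw [H1.fn_conjugate, hd x hx, map_zero])
  rw [H1.inner_eq_bil, H1.conjugate_conjugate] at this
  simpa only [H1.fn_conjugate, Complex.conj_conj] using this

theorem mem_Tmax_of_bil {u v : C.H1}
    (hw : ∀ (c d : Ivl a b) (ψ : C.H1), c ≤ d → (∀ x ≤ c, ψ.fn x = 0) → (∀ x ≥ d, ψ.fn x = 0) →
      H1.bil univ ψ u = C.rho.oint (fun t => ψ.fn t * v.fn t) c d) : (u, v) ∈ C.Tmax := by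
  refine mem_Tmax_of_weak fun c d φ hcd hc hd => ?_
  rw [H1.inner_eq_bil]
  exact hw c d φ.conjugate hcd (fun x hx => by rw [H1.fn_conjugate, hc x hx, map_zero])
    (fun x hx => by rw [H1.fn_conjugate, hd x hx, map_zero])

/-- Testing against the conjugate pair, which is again in `T_max`, removes the conjugations from the
adjoint condition. -/
theorem bil_eq_of_mem_adjoint {f g : C.H1 × C.H1} (hf : f ∈ C.Tmax.adjoint) (hg : g ∈ C.Tmax) :
    H1.bil univ g.2 f.1 = H1.bil univ g.1 f.2 := by
  have := (Submodule.mem_adjoint_iff _ _).1 hf _ _ (conjPair_mem_Tmax hg)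
  rw [H1.inner_eq_bil, H1.inner_eq_bil, H1.conjugate_conjugate, H1.conjugate_conjugate] at this
  exact sub_eq_zero.1 this

theorem locallyIntegrable_fn_mul_fn (f g : C.H1) :
    LocallyIntegrable (fun t => f.fn t * g.fn t) C.rho.variation :=
  f.hasRN.locallyIntegrable_mul g.hasRN.locallyIntegrable

theorem mem_Tmax_of_mem_adjoint {f : C.H1 × C.H1} (hf : f ∈ C.Tmax.adjoint) : f ∈ C.Tmax := by
  refine mem_Tmax_of_bil fun c d φ hcd hc hd => ?_
  obtain ⟨L, hL⟩ := exists_oint_functional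
    (φ.hasRN.locallyIntegrable (ν := C.rho.variation)) hcd
  obtain ⟨h, hh⟩ := exists_forall_bil_eq L
  -- For a test function `ψ` the integral of `φ ψ` may be taken over the support interval of either
  -- factor, so the defining property of `h` is its weak equation.
  have hT : (h, φ) ∈ C.Tmax := by
    refine mem_Tmax_of_bil fun c' d' ψ hcd' hc' hd' => ?_
    rw [H1.bil_comm, hh, hL]
    simp only [mul_comm (φ.fn _)]
    refine RealMeasure.oint_eq_of_support (locallyIntegrable_fn_mul_fn ψ φ)
      (fun x hx => ?_) (fun x hx => ?_) (fun x hx => ?_) (fun x hx => ?_)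
    · rw [hc x hx.le, mul_zero]
    · rw [hd x hx, mul_zero]
    · rw [hc' x hx.le, zero_mul]
    · rw [hd' x hx, zero_mul]
  rw [bil_eq_of_mem_adjoint hf hT, hh, hL]

/-- For every `g ∈ T_max` and every cut-off `K`, there is a pair `(h, K g_τ) ∈ T_max`. -/
theorem exists_cut_mem_Tmax {g : C.H1 × C.H1} (hg : g ∈ C.Tmax) {α β : Ivl a b} (hαβ : α < β)
    {K : C.H1 →L[ℂ] C.H1} (hKα : ∀ f : C.H1, ∀ x ≤ α, (K f).fn x = f.fn x)
    (hKβ : ∀ f : C.H1, ∀ x ≥ β, (K f).fn x = 0) :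
    ∃ h : C.H1, (h, K g.2) ∈ C.Tmax ∧ ∀ ψ : C.H1, H1.bil univ h ψ = H1.bil univ (K ψ) g.1 +
      C.rho.oint (fun t => (K g.2).fn t * ψ.fn t) α β -
      C.rho.oint (fun t => (K ψ).fn t * g.2.fn t) α β := by
  obtain ⟨L₁, hL₁⟩ := exists_oint_functional
    ((K g.2).hasRN.locallyIntegrable (ν := C.rho.variation)) hαβ.le
  obtain ⟨L₂, hL₂⟩ := exists_oint_functional
    (g.2.hasRN.locallyIntegrable (ν := C.rho.variation)) hαβ.le
  -- The natural functional `ψ ↦ ∫ (K g_τ) ψ dϱ` need not make sense near `a`. Its part to the left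
  -- of `α`, where `K g_τ = g_τ`, is replaced by `bil(K ψ, g) - ∫_{[α,β)} (K ψ) g_τ dϱ`. This is
  -- bounded on `H¹` and agrees with that part for compactly supported `ψ`.
  obtain ⟨h, hh⟩ := exists_forall_bil_eq ((innerSL ℂ g.1.conjugate).comp K + L₁ - L₂.comp K)
  have key : ∀ ψ : C.H1, H1.bil univ h ψ = H1.bil univ (K ψ) g.1 +
      C.rho.oint (fun t => (K g.2).fn t * ψ.fn t) α β -
      C.rho.oint (fun t => (K ψ).fn t * g.2.fn t) α β := by
    intro ψ
    rw [hh ψ]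
    change inner ℂ g.1.conjugate (K ψ) + L₁ ψ - L₂ (K ψ) = _
    rw [H1.inner_eq_bil, H1.conjugate_conjugate, hL₁, hL₂, H1.bil_comm]
    simp only [mul_comm (g.2.fn _)]
  refine ⟨h, mem_Tmax_of_bil fun c d ψ hcd hc hd => ?_, key⟩
  have hc' : ∀ x ≤ min c α, (K ψ).fn x = 0 := fun x hx => by
    rw [hKα ψ x (hx.trans (min_le_right _ _)), hc x (hx.trans (min_le_left _ _))]
  have hmβ : min c α ≤ β := (min_le_right _ _).trans hαβ.le
  rw [H1.bil_comm, key ψ, bil_eq_oint_of_mem_Tmax hg hmβ hc' (hKβ ψ),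
    ← RealMeasure.oint_add_adjacent (locallyIntegrable_fn_mul_fn (K ψ) g.2) _ α,
    RealMeasure.oint_congr (min_le_right c α) (k := fun t => ψ.fn t * (K g.2).fn t) fun t ht => by
      rw [hKα _ t ht.2.le, hKα _ t ht.2.le]]
  have e := RealMeasure.oint_add_adjacent (locallyIntegrable_fn_mul_fn ψ (K g.2)) (min c α) α β
  simp only [mul_comm _ (ψ.fn _)]
  rw [add_right_comm, add_sub_cancel_right, e]
  refine RealMeasure.oint_eq_of_support (locallyIntegrable_fn_mul_fn ψ (K g.2))
    (fun x hx => ?_) (fun x hx => ?_) (fun x hx => ?_) (fun x hx => ?_)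
  · rw [hc x (hx.le.trans (min_le_left _ _)), zero_mul]
  · rw [hKβ _ x hx, mul_zero]
  · rw [hc x hx.le, zero_mul]
  · rw [hd x hx, zero_mul]

/-- Testing `f` against `(h, K g_τ)` gives an identity between forms of functions vanishing beyond
`β`. Truncated to `[x, β)`, the defect in this identity is exactly `V(f, g)(x)`, which therefore
tends to `0`. -/
theorem tendsto_V_atBot_of_mem_adjoint {f g : C.H1 × C.H1} (hf : f ∈ C.Tmax.adjoint)
    (hg : g ∈ C.Tmax) : Tendsto (C.V (C.fnPair f) (C.fnPair g)) atBot (𝓝 0) := by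
  obtain ⟨α⟩ := C.nonempty_ivl
  obtain ⟨β, hαβ⟩ := exists_gt α
  obtain ⟨K, hK⟩ := exists_cut (C := C) hαβ
  have hKα := fun f => (hK f).1
  have hKβ := fun f => (hK f).2
  have hfT := mem_Tmax_of_mem_adjoint hf
  obtain ⟨h, hT, hh⟩ := exists_cut_mem_Tmax hg hαβ hKα hKβ
  have hadj := bil_eq_of_mem_adjoint hf hT
  rw [hh] at hadj
  have hIio : ∀ u v : C.H1, H1.bil univ (K u) v = H1.bil (Iio β) (K u) v := fun u v => by
    rw [← H1.bil_Iio_add_bil_Ici β, H1.bil_Ici_eq_zero (hKβ u), add_zero]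
  rw [hIio, hIio] at hadj
  have hlim := ((H1.tendsto_bil_atBot β (K g.2) f.1).sub
    (H1.tendsto_bil_atBot β (K f.2) g.1)).sub_const
      (C.rho.oint (fun t => (K g.2).fn t * f.2.fn t) α β -
        C.rho.oint (fun t => (K f.2).fn t * g.2.fn t) α β)
  -- On `[x, α)` the cut-off is invisible, so for `(g_τ, f)` and `(f_τ, g)` the `ϱ`-integrals there
  -- are both `∫ f_τ g_τ dϱ` and cancel; those over `[α, β)` cancel against the ones in `hlim`.
  have hpart : ∀ {u : C.H1} {p : C.H1 × C.H1}, p ∈ C.Tmax → ∀ x ≤ α,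
      H1.bil (Ico x β) (K u) p.1 = C.rho.oint (fun t => u.fn t * p.2.fn t) x α +
        C.rho.oint (fun t => (K u).fn t * p.2.fn t) α β - u.fn x * C.quasiDeriv p.1.fn x := by
    intro u p hp x hx
    have e := green hp (K u) (hx.trans hαβ.le)
    rw [hKβ u β le_rfl, hKα u x hx,
      ← RealMeasure.oint_add_adjacent (locallyIntegrable_fn_mul_fn (K u) p.2) x α β,
      RealMeasure.oint_congr hx (k := fun t => u.fn t * p.2.fn t) fun t ht => by
        rw [hKα _ t ht.2.le]] at e
    linear_combination -e
  have hval : H1.bil (Iio β) (K g.2) f.1 - H1.bil (Iio β) (K f.2) g.1 -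
      (C.rho.oint (fun t => (K g.2).fn t * f.2.fn t) α β -
        C.rho.oint (fun t => (K f.2).fn t * g.2.fn t) α β) = 0 := by
    linear_combination hadj
  rw [hval] at hlim
  refine hlim.congr' ?_
  filter_upwards [eventually_le_atBot α] with x hx
  rw [hpart hfT x hx, hpart hg x hx]
  simp only [mul_comm (g.2.fn _) (f.2.fn _), V, fnPair]
  ring

theorem mem_adjoint_Tmax_iff {f : C.H1 × C.H1} :
    f ∈ C.Tmax.adjoint ↔ f ∈ C.Tmax ∧ ∀ g ∈ C.Tmax,
      Tendsto (C.V (C.fnPair f) (C.fnPair g)) atBot (𝓝 0) ∧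
      Tendsto (C.V (C.fnPair f) (C.fnPair g)) atTop (𝓝 0) := by
  constructor
  · intro hf
    have hfT := mem_Tmax_of_mem_adjoint hf
    refine ⟨hfT, fun g hg => ?_⟩
    have h0 := tendsto_V_atBot_of_mem_adjoint hf hg
    refine ⟨h0, ?_⟩
    have h1 := tendsto_V_atTop_of_atBot hfT hg h0
    -- The difference of the two boundary values is the global form that vanishes by adjointness, so
    -- no second cut-off at `b` is needed.
    rwa [H1.bil_comm _ f.1, bil_eq_of_mem_adjoint hf hg, H1.bil_comm, sub_self, add_zero] at h1
  · rintro ⟨hf, hV⟩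
    refine (Submodule.mem_adjoint_iff _ _).2 fun x y hxy => ?_
    obtain ⟨h0, h1⟩ := hV _ (conjPair_mem_Tmax hxy)
    obtain ⟨c⟩ := C.nonempty_ivl
    have : Nonempty (Ivl a b) := ⟨c⟩
    have e := tendsto_nhds_unique h1 (tendsto_V_atTop_of_atBot hf (conjPair_mem_Tmax hxy) h0)
    rw [H1.inner_eq_bil, H1.inner_eq_bil, H1.bil_comm, H1.bil_comm _ x.conjugate]
    simp only [conjPair] at e
    linear_combination e

end Coeff

end LeftDefinite

/-! ### The main theorem. -/

theorem mainTheorem12 {a b : EReal} (C : LeftDefinite.Coeff a b) :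
    (∀ f ∈ C.Tmax, ∀ g ∈ C.Tmax,
      (∃ l : ℂ, Tendsto (C.V (C.fnPair f) (C.fnPair g)) atBot (𝓝 l)) ∧
      (∃ l : ℂ, Tendsto (C.V (C.fnPair f) (C.fnPair g)) atTop (𝓝 l))) ∧
    IsClosed (C.Tmax : Set (C.H1 × C.H1)) ∧
    (C.Tmax.adjoint : Set (C.H1 × C.H1)) =
      {f | f ∈ C.Tmax ∧ ∀ g ∈ C.Tmax,
        Tendsto (C.V (C.fnPair f) (C.fnPair g)) atBot (𝓝 0) ∧
        Tendsto (C.V (C.fnPair f) (C.fnPair g)) atTop (𝓝 0)} := by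
  obtain ⟨c⟩ := C.nonempty_ivl
  refine ⟨fun f hf g hg => ⟨⟨_, LeftDefinite.Coeff.tendsto_V_atBot hf hg c⟩,
    ⟨_, LeftDefinite.Coeff.tendsto_V_atTop hf hg c⟩⟩, LeftDefinite.Coeff.isClosed_Tmax, ?_⟩
  ext f
  exact LeftDefinite.Coeff.mem_adjoint_Tmax_iff
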